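/- Let $n\ge 1$, let $a:[0,\infty)\to\mathbb R$ be continuous and convex, and let $\mu$ be the measure on $\mathbb R^n$ given by $d\mu=|x|^{1-n}e^{a(|x|)}\,dx$. Call a set $M\subset\mathbb R^n$ smooth if it is bounded and open and there is $\varepsilon>0$ such that for every $x_0\in\partial M$ the set $\partial M\cap B_\varepsilon(x_0)$ is a Lipschitz graph (the part in $B_\varepsilon(x_0)$ of the graph of a Lipschitz function over a hyperplane) and $M\cap B_\varepsilon(x_0)$ is the part of $B_\varepsilon(x_0)$ lying strictly on one side of it. For a Borel set $M$ with $\mu(M)<\infty$ let $$\mu^+(M)=\liminf_{r\to0^+}\frac{\mu(M_r)-\mu(M)}{r},\qquad M_r=\{x:\operatorname{dist}(x,M)<r\},$$ be its lower outer Minkowski $\mu$-content. Let $\omega_n$ be the Lebesgue measure of the unit ball of $\mathbb R^n$, $\mathcal H^{n-1}$ the $(n-1)$-dimensional Hausdorff measure with its usual normalization, and $B_R$ the open ball of radius $R$ centred at the origin. Let $\Omega\subset\mathbb R^n$ be a smooth set which contains a neighbourhood of the origin and satisfies $\mu(\Omega)<\infty$. Then there is exactly one $R>0$ with $\mu(B_R)=\mu(\Omega)$,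 and for this $R$ $$\mu^+(\Omega)=\int_{\partial\Omega}|x|^{1-n}e^{a(|x|)}\,\mathcal H^{n-1}(dx)\ \ge\ n\omega_n e^{a(R)}=\mu^+(B_R)=\int_{\partial B_R}|x|^{1-n}e^{a(|x|)}\,\mathcal H^{n-1}(dx).$$ -/

import Mathlib

open MeasureTheory Filter Topology

noncomputable section

/-- The density `|x|^(1-n) * exp (a |x|)` on `ℝⁿ` (its value at the origin is immaterial). -/
def radialDensity (n : ℕ) (a : ℝ → ℝ) (x : EuclideanSpace ℝ (Fin n)) : ENNReal :=
  ENNReal.ofReal (‖x‖ ^ (1 - (n : ℤ)) * Real.exp (a ‖x‖))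

/-- The measure `dμ = |x|^(1-n) * exp (a |x|) dx` on `ℝⁿ`. -/
def radialMeasure (n : ℕ) (a : ℝ → ℝ) : Measure (EuclideanSpace ℝ (Fin n)) :=
  volume.withDensity (radialDensity n a)

/-- Smooth sets: bounded open sets `M` for which there is `ε > 0` such that, in the ball of radius
`ε` about any boundary point, the boundary is the graph of a Lipschitz function `g` over the
hyperplane orthogonal to some unit vector `e`, and `M` lies on one side of that graph, namely it
is the part of the ball below it. The point `x - ⟪e, x⟫ e` is the orthogonal projection of `x`
onto that hyperplane; only the values of `g` on the hyperplane matter. -/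
def IsSmoothSet {n : ℕ} (M : Set (EuclideanSpace ℝ (Fin n))) : Prop :=
  Bornology.IsBounded M ∧ IsOpen M ∧
    ∃ ε : ℝ, 0 < ε ∧ ∀ x₀ ∈ frontier M,
      ∃ (e : EuclideanSpace ℝ (Fin n)) (g : EuclideanSpace ℝ (Fin n) → ℝ) (K : NNReal),
        ‖e‖ = 1 ∧ LipschitzWith K g ∧
        ∀ x ∈ Metric.ball x₀ ε,
          (x ∈ frontier M ↔ inner ℝ e x = g (x - (inner ℝ e x : ℝ) • e)) ∧
          (x ∈ M ↔ inner ℝ e x < g (x - (inner ℝ e x : ℝ) • e))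

/-- The (lower outer) Minkowski `μ`-content
`liminf_{r → 0+} (μ (M_r) - μ M) / r`, where `M_r = {x | dist (x, M) < r}`.
(It is used for sets `M` of finite measure, so that the difference is the true one.) -/
def minkowskiContent {n : ℕ} (μ : Measure (EuclideanSpace ℝ (Fin n)))
    (M : Set (EuclideanSpace ℝ (Fin n))) : ENNReal :=
  liminf (fun r : ℝ => (μ (Metric.thickening r M) - μ M) / ENNReal.ofReal r) (𝓝[>] (0 : ℝ))

/-- The weighted boundary measure `∫_{∂M} |x|^(1-n) * exp (a |x|) dH^{n-1}`, where `H^{n-1}` is the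
Hausdorff measure normalised as usual, i.e. agreeing with Lebesgue measure on `ℝ^(n-1)`. -/
def weightedPerimeter (n : ℕ) (a : ℝ → ℝ) (M : Set (EuclideanSpace ℝ (Fin n))) : ENNReal :=
  ∫⁻ x in frontier M, radialDensity n a x ∂(Measure.euclideanHausdorffMeasure (n - 1))

/-- `ω_n`, the Lebesgue measure of the unit ball of `ℝⁿ`. -/
def unitBallVolume (n : ℕ) : ENNReal :=
  volume (Metric.ball (0 : EuclideanSpace ℝ (Fin n)) 1)

end

/-! ### Hausdorff measure of Lipschitz graphs -/

section AreaFormula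

open scoped ENNReal NNReal

/-! The inequality is Jensen's inequality along rays. In polar coordinates `|x|^(1-n)` cancels the
Jacobian, so μ is `exp (a r) dr dσ(θ)`, with σ the surface measure of the unit sphere. Put `A s =
∫₀ˢ exp a`; then `μ (B_R) = n ω_n A R`, which is strictly increasing and continuous in `R`, and this
gives existence and uniqueness of the radius.

Formally `d(exp a)/dA = a'`, so `exp a` is a convex function of the variable `A` and has a
supporting line of some slope `c` at `A R` (`ConvexOn.exists_exp_supporting_line`). Let `m θ` be the
mass of Ω on the ray θ; its mean is `A R`, so the supporting line evaluated at `m θ` has mean `exp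
(a R)`. If `t` and `v` are the first and last exit radii of the ray, then `A t ≤ m θ ≤ A v`.
According to the sign of `c`, one of these two boundary points has `exp a` at least the value of the
line at `m θ`. Finally, radial projection onto the sphere satisfies `σ (shadow of S) ≤ ∫_S |x|^(1-n)
dH^{n-1}`; applied to superlevel sets (`lintegral_toSphere_le_of_exists_mem`) it bounds the weighted
perimeter below by the integral of the line over the sphere, with no measurable choice of boundary
points.

The identity between Minkowski content and boundary integral is local. Above a point where the
Lipschitz function γ is differentiable, the collar of width `r` of its subgraph has height
asymptotic to `r √(1 + ‖∇γ‖²)`. Rademacher's theorem and dominated convergence give the limit, the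
area formula identifies it with a Hausdorff integral, and a partition of unity globalizes it
(`IsSmoothSet.tendsto_lintegral_collar`). The singularity of the density at the origin lies inside Ω
and does not matter. The same theorem, applied to the unit ball and compared with polar coordinates,
identifies σ with `H^{n-1}` on the sphere. -/

theorem euclideanHausdorffMeasure_image_le_of_edist_le {X Y Z : Type*}
    [EMetricSpace Y] [MeasurableSpace Y] [BorelSpace Y]
    [EMetricSpace Z] [MeasurableSpace Z] [BorelSpace Z] (d : ℕ) (K : ℝ≥0)
    {f : X → Y} {g : X → Z} {S : Set X}
    (h : ∀ x ∈ S, ∀ y ∈ S, edist (f x) (f y) ≤ K * edist (g x) (g y)) :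
    Measure.euclideanHausdorffMeasure d (f '' S) ≤
      (K : ℝ≥0∞) ^ d * Measure.euclideanHausdorffMeasure d (g '' S) := by
  classical
  rcases S.eq_empty_or_nonempty with rfl | ⟨x₀, hx₀⟩
  · simp
  have : Nonempty X := ⟨x₀⟩
  -- The hypothesis makes `f` constant on the fibres of `g` in `S`, so `f ∘ k` does not depend on
  -- the chosen section and is `K`-Lipschitz on `g '' S`.
  let k : Z → X := Function.invFunOn g S
  have hkS : ∀ z ∈ g '' S, k z ∈ S := fun z hz => Function.invFunOn_mem hz
  have hgk : ∀ z ∈ g '' S, g (k z) = z := fun z hz => Function.invFunOn_eq hz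
  have hL : LipschitzOnWith K (f ∘ k) (g '' S) := by
    intro z hz w hw
    have := h _ (hkS z hz) _ (hkS w hw)
    rwa [hgk z hz, hgk w hw] at this
  have himg : f '' S = (f ∘ k) '' (g '' S) := by
    ext y
    constructor
    · rintro ⟨x, hx, rfl⟩
      refine ⟨g x, ⟨x, hx, rfl⟩, ?_⟩
      have hz : g x ∈ g '' S := ⟨x, hx, rfl⟩
      have := h _ (hkS _ hz) x hx
      rw [hgk _ hz, edist_self, mul_zero, nonpos_iff_eq_zero, edist_eq_zero] at this
      exact this
    · rintro ⟨z, hz, rfl⟩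
      exact ⟨k z, hkS z hz, rfl⟩
  have := hL.hausdorffMeasure_image_le (d := (d : ℝ)) (by positivity)
  rw [← himg, ENNReal.rpow_natCast] at this
  simp only [Measure.euclideanHausdorffMeasure_def, Measure.smul_apply, ENNReal.smul_def,
    smul_eq_mul]
  calc _ ≤ _ := mul_le_mul_right this _
    _ = _ := by ring

/-- The area element `√(1 + ‖p‖²)` of a graph with slope `p`. -/
noncomputable def areaElement {F : Type*} [NormedAddCommGroup F] [NormedSpace ℝ F]
    (p : F →L[ℝ] ℝ) : ℝ := √(1 + ‖p‖ ^ 2)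

theorem one_le_areaElement {F : Type*} [NormedAddCommGroup F] [NormedSpace ℝ F] (p : F →L[ℝ] ℝ) : 1 ≤ areaElement p := by
  rw [areaElement, Real.one_le_sqrt]
  nlinarith [sq_nonneg ‖p‖]

theorem areaElement_sq {F : Type*} [NormedAddCommGroup F] [NormedSpace ℝ F] (p : F →L[ℝ] ℝ) : areaElement p ^ 2 = 1 + ‖p‖ ^ 2 :=
  Real.sq_sqrt (by positivity)

/-- Triangle inequality in the Euclidean plane for the points `(a, b)` and `(a, c)`. -/
theorem sqrt_sq_add_sq_le (a b c : ℝ) : √(a ^ 2 + b ^ 2) ≤ √(a ^ 2 + c ^ 2) + |b - c| := by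
  have h1 : 0 ≤ √(a ^ 2 + c ^ 2) := Real.sqrt_nonneg _
  have h2 := Real.sq_sqrt (show 0 ≤ a ^ 2 + c ^ 2 by positivity)
  have h3 : |c| ≤ √(a ^ 2 + c ^ 2) := by
    rw [← Real.sqrt_sq_eq_abs]
    exact Real.sqrt_le_sqrt (by nlinarith)
  rw [Real.sqrt_le_left (by positivity)]
  have h4 : c * (b - c) ≤ √(a ^ 2 + c ^ 2) * |b - c| := by
    calc c * (b - c) ≤ |c * (b - c)| := le_abs_self _
      _ = |c| * |b - c| := abs_mul _ _
      _ ≤ _ := by gcongr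
  nlinarith [sq_abs (b - c)]

theorem areaElement_le_add {F : Type*} [NormedAddCommGroup F] [NormedSpace ℝ F] (p q : F →L[ℝ] ℝ) :
    areaElement p ≤ areaElement q + ‖p - q‖ := by
  have := sqrt_sq_add_sq_le 1 ‖p‖ ‖q‖
  rw [one_pow] at this
  exact this.trans (add_le_add le_rfl (abs_norm_sub_norm_le p q))

/-- A linear endomorphism with the same norm distortion as the graph map `w ↦ (w, p w)`. -/
theorem exists_linearMap_norm_sq_eq {F : Type*} [NormedAddCommGroup F] [InnerProductSpace ℝ F]
    [FiniteDimensional ℝ F] (p : F →L[ℝ] ℝ) :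
    ∃ B : F →ₗ[ℝ] F, (∀ w, ‖B w‖ ^ 2 = ‖w‖ ^ 2 + (p w) ^ 2) ∧
      LinearMap.det B = areaElement p := by
  set v : F := (InnerProductSpace.toDual ℝ F).symm p with hv
  have hpv : ∀ w, inner ℝ v w = p w := fun w => InnerProductSpace.toDual_symm_apply
  have hnv : ‖v‖ = ‖p‖ := by simp [hv]
  have hpp : p v = ‖p‖ ^ 2 := by rw [← hpv, real_inner_self_eq_norm_sq, hnv]
  set c := areaElement p
  have hc : 1 ≤ c := one_le_areaElement p
  have hc2 : c ^ 2 = 1 + ‖p‖ ^ 2 := areaElement_sq p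
  have hc0 : 1 + c ≠ 0 := by positivity
  -- The factor `s = (1 + c)⁻¹` solves `2 s + s² ‖p‖² = 1`, which is what the norm identity
  -- requires; then the determinant `1 + s ‖p‖²` equals `c`.
  refine ⟨LinearMap.transvection (p : F →ₗ[ℝ] ℝ) ((1 + c)⁻¹ • v), fun w => ?_, ?_⟩
  · have h1 : LinearMap.transvection (p : F →ₗ[ℝ] ℝ) ((1 + c)⁻¹ • v) w
        = w + (p w * (1 + c)⁻¹) • v := by
      rw [LinearMap.transvection.apply, smul_smul]; rfl
    rw [h1, norm_add_sq_real, real_inner_smul_right, real_inner_comm, hpv, norm_smul, mul_pow,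
      hnv, Real.norm_eq_abs, sq_abs]
    have : ‖p‖ ^ 2 = c ^ 2 - 1 := by linarith
    rw [this]
    field_simp
    ring
  · rw [LinearMap.transvection.det]
    have : (p : F →ₗ[ℝ] ℝ) ((1 + c)⁻¹ • v) = (1 + c)⁻¹ * ‖p‖ ^ 2 := by
      simp [hpp]
    rw [this]
    have : ‖p‖ ^ 2 = c ^ 2 - 1 := by linarith
    rw [this]
    field_simp
    ring

/-- `f` parametrizes an isometric copy of the graph of `γ`. -/
def IsGraphMap {F X : Type*} [NormedAddCommGroup F] [MetricSpace X]
    (f : F → X) (γ : F → ℝ) : Prop :=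
  ∀ y z, dist (f y) (f z) ^ 2 = ‖y - z‖ ^ 2 + (γ y - γ z) ^ 2

theorem IsGraphMap.dist_eq {F X : Type*} [NormedAddCommGroup F] [MetricSpace X]
    {f : F → X} {γ : F → ℝ} (hf : IsGraphMap f γ) (y z : F) :
    dist (f y) (f z) = √(‖y - z‖ ^ 2 + (γ y - γ z) ^ 2) := by
  rw [← hf, Real.sqrt_sq dist_nonneg]

theorem IsGraphMap.antilipschitzWith {F X : Type*} [NormedAddCommGroup F] [MetricSpace X]
    {f : F → X} {γ : F → ℝ} (hf : IsGraphMap f γ) : AntilipschitzWith 1 f := by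
  apply AntilipschitzWith.of_le_mul_dist
  intro y z
  rw [hf.dist_eq, NNReal.coe_one, one_mul, dist_eq_norm]
  apply Real.le_sqrt_of_sq_le
  nlinarith [sq_nonneg (γ y - γ z)]

theorem IsGraphMap.lipschitzWith {F X : Type*} [NormedAddCommGroup F] [MetricSpace X]
    {f : F → X} {γ : F → ℝ} (hf : IsGraphMap f γ) {K : ℝ≥0} (hγ : LipschitzWith K γ) :
    LipschitzWith (1 + K) f := by
  apply LipschitzWith.of_dist_le_mul
  intro y z
  have h1 := sqrt_sq_add_sq_le ‖y - z‖ (γ y - γ z) 0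
  have h2 := hγ.dist_le_mul y z
  rw [← hf.dist_eq, zero_pow two_ne_zero, add_zero, Real.sqrt_sq (norm_nonneg _), sub_zero,
    ← Real.dist_eq, ← dist_eq_norm] at h1
  rw [NNReal.coe_add, NNReal.coe_one]
  linarith

variable {F : Type*} [NormedAddCommGroup F] [InnerProductSpace ℝ F] [FiniteDimensional ℝ F]
  [MeasurableSpace F] [BorelSpace F]

variable {X : Type*} [MetricSpace X] [MeasurableSpace X] [BorelSpace X]

/-- On `P` the increments of `γ` and `p` differ by at most `δ ‖y - z‖`, so distances under the graph
map and under the linear model `B` agree up to the factor `κ`. Hausdorff measure then changes by at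
most `κ ^ m`, `m` being the dimension, and `B` scales volume by its determinant. -/
theorem IsGraphMap.measure_image_approx {f : F → X} {γ : F → ℝ} (hf : IsGraphMap f γ)
    {P : Set F} {p : F →L[ℝ] ℝ} {κ δ : ℝ≥0} (hδ : 1 + δ ≤ κ) (hδ' : 1 ≤ κ * (1 - (δ : ℝ)))
    (hP : ApproximatesLinearOn γ p P δ) :
    Measure.euclideanHausdorffMeasure (Module.finrank ℝ F) (f '' P) ≤
        (κ : ℝ≥0∞) ^ (Module.finrank ℝ F) * (ENNReal.ofReal (areaElement p) * volume P) ∧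
      ENNReal.ofReal (areaElement p) * volume P ≤ (κ : ℝ≥0∞) ^ (Module.finrank ℝ F) *
        Measure.euclideanHausdorffMeasure (Module.finrank ℝ F) (f '' P) := by
  obtain ⟨B, hB, hdet⟩ := exists_linearMap_norm_sq_eq p
  have hBd : ∀ y z, dist (B y) (B z) = √(‖y - z‖ ^ 2 + (p (y - z)) ^ 2) := by
    intro y z
    rw [dist_eq_norm, ← map_sub, ← hB, Real.sqrt_sq (norm_nonneg _)]
  have hle : ∀ y z, ‖y - z‖ ≤ dist (B y) (B z) := by
    intro y z
    rw [hBd]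
    apply Real.le_sqrt_of_sq_le
    nlinarith [sq_nonneg (p (y - z))]
  have hvol : ENNReal.ofReal (areaElement p) * volume P =
      Measure.euclideanHausdorffMeasure (Module.finrank ℝ F) (B '' P) := by
    rw [InnerProductSpace.euclideanHausdorffMeasure_eq_volume, Measure.addHaar_image_linearMap,
      hdet, abs_of_nonneg (zero_le_one.trans (one_le_areaElement p))]
  have happ : ∀ y ∈ P, ∀ z ∈ P, |(γ y - γ z) - p (y - z)| ≤ δ * ‖y - z‖ := by
    intro y hy z hz
    simpa using hP y hy z hz
  rw [hvol]
  constructor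
  · apply euclideanHausdorffMeasure_image_le_of_edist_le
    intro y hy z hz
    rw [edist_dist, edist_dist, ← ENNReal.ofReal_coe_nnreal, ← ENNReal.ofReal_mul (by positivity)]
    apply ENNReal.ofReal_le_ofReal
    have h1 := sqrt_sq_add_sq_le ‖y - z‖ (γ y - γ z) (p (y - z))
    rw [← hf.dist_eq, ← hBd] at h1
    have h2 := happ y hy z hz
    have h3 := hle y z
    have h4 : (δ : ℝ) * ‖y - z‖ ≤ δ * dist (B y) (B z) := by gcongr
    have h5 : (1 + (δ : ℝ)) * dist (B y) (B z) ≤ κ * dist (B y) (B z) := by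
      gcongr
      exact_mod_cast hδ
    linarith
  · apply euclideanHausdorffMeasure_image_le_of_edist_le
    intro y hy z hz
    rw [edist_dist, edist_dist, ← ENNReal.ofReal_coe_nnreal, ← ENNReal.ofReal_mul (by positivity)]
    apply ENNReal.ofReal_le_ofReal
    have h1 := sqrt_sq_add_sq_le ‖y - z‖ (p (y - z)) (γ y - γ z)
    rw [← hf.dist_eq, ← hBd, abs_sub_comm] at h1
    have h2 := happ y hy z hz
    have h3 := hle y z
    have h4 : (δ : ℝ) * ‖y - z‖ ≤ δ * dist (B y) (B z) := by gcongr
    have h5 : (1 - (δ : ℝ)) * dist (B y) (B z) ≤ dist (f y) (f z) := by linarith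
    have h6 : 0 ≤ dist (B y) (B z) := dist_nonneg
    calc dist (B y) (B z) ≤ (κ * (1 - (δ : ℝ))) * dist (B y) (B z) := by nlinarith
      _ = κ * ((1 - (δ : ℝ)) * dist (B y) (B z)) := by ring
      _ ≤ _ := by gcongr

theorem IsGraphMap.measurableEmbedding {f : F → X} {γ : F → ℝ} (hf : IsGraphMap f γ)
    {K : ℝ≥0} (hγ : LipschitzWith K γ) : MeasurableEmbedding f :=
  (hf.antilipschitzWith.isClosedEmbedding (hf.lipschitzWith hγ).uniformContinuous).measurableEmbedding

/-- If two measures are comparable on the pieces of a countable cover, they are comparable. -/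
theorem measure_le_of_cover {α : Type*} [MeasurableSpace α] {μ ν : Measure α} {T : Set α}
    (P : ℕ → Set α) (hP : ∀ i, MeasurableSet (P i)) (hT : T ⊆ ⋃ i, P i)
    (h : ∀ i, ∀ S ⊆ P i, S ⊆ T → MeasurableSet S → μ S ≤ ν S) {S : Set α} (hS : MeasurableSet S)
    (hST : S ⊆ T) : μ S ≤ ν S := by
  have hdec : S = ⋃ i, S ∩ disjointed P i := by
    rw [← Set.inter_iUnion, iUnion_disjointed, Set.inter_eq_left.2 (hST.trans hT)]
  have hmeas : ∀ i, MeasurableSet (S ∩ disjointed P i) :=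
    fun i => hS.inter (MeasurableSet.disjointed hP i)
  have hdisj : Pairwise (Function.onFun Disjoint fun i => S ∩ disjointed P i) := by
    intro i j hij
    exact (disjoint_disjointed P hij).mono Set.inter_subset_right Set.inter_subset_right
  rw [hdec, measure_iUnion hdisj hmeas, measure_iUnion hdisj hmeas]
  refine ENNReal.tsum_le_tsum fun i => h i _ ?_ ?_ (hmeas i)
  · exact Set.inter_subset_right.trans (disjointed_subset P i)
  · exact Set.inter_subset_left.trans hST

/-- The measure on `F` with density the area element of the graph of `γ`. -/
noncomputable def graphAreaMeasure (γ : F → ℝ) : Measure F :=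
  volume.withDensity fun y => ENNReal.ofReal (areaElement (fderiv ℝ γ y))

theorem measurable_areaElement_fderiv {F : Type*} [NormedAddCommGroup F] [InnerProductSpace ℝ F]
    [MeasurableSpace F] [BorelSpace F] (γ : F → ℝ) :
    Measurable fun y => areaElement (fderiv ℝ γ y) := by
  unfold areaElement
  have := measurable_fderiv ℝ γ
  fun_prop

/-- Of the `m + 1` factors `κ`, `m` come from the distortion of distances and one from replacing the
true gradient by the constant slope of a piece. -/
theorem IsGraphMap.measure_image_comparable {f : F → X} {γ : F → ℝ} (hf : IsGraphMap f γ)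
    {K : ℝ≥0} (hγ : LipschitzWith K γ) {κ : ℝ≥0} (hκ : 1 < κ) {S : Set F} (hS : MeasurableSet S)
    (hd : ∀ y ∈ S, DifferentiableAt ℝ γ y) :
    Measure.comap f (Measure.euclideanHausdorffMeasure (Module.finrank ℝ F)) S ≤
        ((κ : ℝ≥0∞) ^ (Module.finrank ℝ F + 1) • graphAreaMeasure γ) S ∧
      graphAreaMeasure γ S ≤ ((κ : ℝ≥0∞) ^ (Module.finrank ℝ F + 1) •
        Measure.comap f (Measure.euclideanHausdorffMeasure (Module.finrank ℝ F))) S := by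
  set m := Module.finrank ℝ F
  have hemb := hf.measurableEmbedding hγ
  have hκ0 : (0 : ℝ) < κ := by positivity
  have hκ1 : (1 : ℝ) < κ := by exact_mod_cast hκ
  -- sets of almost constant slope
  obtain ⟨u, hu⟩ := TopologicalSpace.exists_dense_seq (F →L[ℝ] ℝ)
  have key : ∀ k, ∀ T ⊆ {y | ‖fderiv ℝ γ y - u k‖ < ((κ : ℝ) - 1) / 2}, T ⊆ S → MeasurableSet T →
      Measure.comap f (Measure.euclideanHausdorffMeasure m) T ≤
        ((κ : ℝ≥0∞) ^ (m + 1) • graphAreaMeasure γ) T ∧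
      graphAreaMeasure γ T ≤ ((κ : ℝ≥0∞) ^ (m + 1) •
        Measure.comap f (Measure.euclideanHausdorffMeasure m)) T := by
    intro k T hTk hTS hT
    -- With this choice `κ (1 - δ) = 1`, and `1 + δ ≤ κ` amounts to `2 ≤ κ + κ⁻¹`.
    set δ : ℝ≥0 := 1 - κ⁻¹ with hδ
    have hδr : (δ : ℝ) = 1 - (κ : ℝ)⁻¹ := by
      rw [hδ, NNReal.coe_sub (inv_le_one_of_one_le₀ hκ.le)]
      simp
    have hinv : (κ : ℝ)⁻¹ < 1 := inv_lt_one_of_one_lt₀ hκ1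
    have hδ0 : δ ≠ 0 := by
      intro h
      rw [h] at hδr
      simp only [NNReal.coe_zero] at hδr
      linarith
    have hmulinv : (κ : ℝ) * (κ : ℝ)⁻¹ = 1 := mul_inv_cancel₀ hκ0.ne'
    have hδκ : 1 + δ ≤ κ := by
      rw [← NNReal.coe_le_coe, NNReal.coe_add, hδr, NNReal.coe_one]
      nlinarith [sq_nonneg ((κ : ℝ) - 1), inv_pos.2 hκ0]
    have hδκ' : 1 ≤ (κ : ℝ) * (1 - (δ : ℝ)) := by
      rw [hδr]; nlinarith
    rcases T.eq_empty_or_nonempty with rfl | hTne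
    · simp
    obtain ⟨t, A, -, ht, hTt, happ, hA⟩ :=
      exists_partition_approximatesLinearOn_of_hasFDerivWithinAt γ T (fderiv ℝ γ)
        (fun x hx => (hd x (hTS hx)).hasFDerivAt.hasFDerivWithinAt) (fun _ => δ) (fun _ => hδ0)
    -- Each `A n` is the derivative at some point of `T`, so it is within `κ - 1` of every
    -- derivative on `T`. Since area elements are at least 1, this additive error is absorbed by a
    -- factor `κ`.
    have hclose : ∀ n, ∀ y ∈ T, areaElement (A n) ≤ κ * areaElement (fderiv ℝ γ y) ∧
        areaElement (fderiv ℝ γ y) ≤ κ * areaElement (A n) := by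
      intro n y hy
      obtain ⟨z, hz, hAz⟩ := hA hTne n
      have h1 : ‖fderiv ℝ γ y - A n‖ ≤ κ - 1 := by
        have e1 := hTk hy
        have e2 := hTk hz
        rw [Set.mem_ofPred_eq] at e1 e2
        rw [hAz]
        calc _ = ‖(fderiv ℝ γ y - u k) - (fderiv ℝ γ z - u k)‖ := by congr 1; abel
          _ ≤ _ := norm_sub_le _ _
          _ ≤ _ := by linarith
      have h2 := areaElement_le_add (fderiv ℝ γ y) (A n)
      have h3 := areaElement_le_add (A n) (fderiv ℝ γ y)
      rw [norm_sub_rev] at h3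
      have h4 := one_le_areaElement (fderiv ℝ γ y)
      have h5 := one_le_areaElement (A n)
      constructor <;> nlinarith
    have hpiece : ∀ n, ∀ R ⊆ t n, R ⊆ T → MeasurableSet R →
        Measure.comap f (Measure.euclideanHausdorffMeasure m) R ≤
          ((κ : ℝ≥0∞) ^ (m + 1) • graphAreaMeasure γ) R ∧
        graphAreaMeasure γ R ≤ ((κ : ℝ≥0∞) ^ (m + 1) •
          Measure.comap f (Measure.euclideanHausdorffMeasure m)) R := by
      intro n R hRt hRT hR
      obtain ⟨h1, h2⟩ := hf.measure_image_approx hδκ hδκ'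
        ((happ n).mono_set (Set.subset_inter hRT hRt))
      have hconst : ENNReal.ofReal (areaElement (A n)) * volume R =
          ∫⁻ _ in R, ENNReal.ofReal (areaElement (A n)) := by simp
      have hmeas := (measurable_areaElement_fderiv γ).ennreal_ofReal
      have hκof : (κ : ℝ≥0∞) = ENNReal.ofReal κ := (ENNReal.ofReal_coe_nnreal).symm
      have hg : graphAreaMeasure γ R = ∫⁻ y in R, ENNReal.ofReal (areaElement (fderiv ℝ γ y)) :=
        withDensity_apply _ hR
      have b1 : ENNReal.ofReal (areaElement (A n)) * volume R ≤ κ * graphAreaMeasure γ R := by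
        rw [hconst, hg, ← lintegral_const_mul _ hmeas]
        refine setLIntegral_mono' hR fun y hy => ?_
        rw [hκof, ← ENNReal.ofReal_mul hκ0.le]
        exact ENNReal.ofReal_le_ofReal (hclose n y (hRT hy)).1
      have b2 : graphAreaMeasure γ R ≤ κ * (ENNReal.ofReal (areaElement (A n)) * volume R) := by
        rw [hconst, hg, ← lintegral_const_mul' _ _ ENNReal.coe_ne_top]
        refine setLIntegral_mono' hR fun y hy => ?_
        rw [hκof, ← ENNReal.ofReal_mul hκ0.le]
        exact ENNReal.ofReal_le_ofReal (hclose n y (hRT hy)).2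
      rw [Measure.smul_apply, Measure.smul_apply, hemb.comap_apply, smul_eq_mul, smul_eq_mul]
      constructor
      · refine h1.trans ?_
        rw [pow_succ, mul_assoc]
        gcongr
      · refine b2.trans ?_
        rw [pow_succ', mul_assoc]
        gcongr
    exact ⟨measure_le_of_cover t ht hTt (fun n R a b c => (hpiece n R a b c).1) hT subset_rfl,
      measure_le_of_cover t ht hTt (fun n R a b c => (hpiece n R a b c).2) hT subset_rfl⟩
  have hmeas : ∀ k, MeasurableSet {y | ‖fderiv ℝ γ y - u k‖ < ((κ : ℝ) - 1) / 2} := by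
    intro k
    have := measurable_fderiv ℝ γ
    exact measurableSet_lt (by fun_prop) measurable_const
  have hcov : S ⊆ ⋃ k, {y | ‖fderiv ℝ γ y - u k‖ < ((κ : ℝ) - 1) / 2} := by
    intro y _
    obtain ⟨k, hk⟩ := hu.exists_dist_lt (fderiv ℝ γ y) (ε := ((κ : ℝ) - 1) / 2) (by linarith)
    rw [dist_eq_norm] at hk
    exact Set.mem_iUnion.2 ⟨k, hk⟩
  exact ⟨measure_le_of_cover _ hmeas hcov (fun n R a b c => (key n R a b c).1) hS subset_rfl,
    measure_le_of_cover _ hmeas hcov (fun n R a b c => (key n R a b c).2) hS subset_rfl⟩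

/-- **Area formula** for Lipschitz graphs. -/
theorem IsGraphMap.comap_euclideanHausdorffMeasure {f : F → X} {γ : F → ℝ} (hf : IsGraphMap f γ)
    {K : ℝ≥0} (hγ : LipschitzWith K γ) :
    Measure.comap f (Measure.euclideanHausdorffMeasure (Module.finrank ℝ F)) =
      graphAreaMeasure γ := by
  set m := Module.finrank ℝ F with hm
  set ν := Measure.comap f (Measure.euclideanHausdorffMeasure m) with hν
  have hemb := hf.measurableEmbedding hγ
  set D := {y | DifferentiableAt ℝ γ y} with hD
  have hDm : MeasurableSet D := measurableSet_of_differentiableAt ℝ γ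
  have hD0 : volume Dᶜ = 0 := hγ.ae_differentiableAt
  -- The set of non-differentiability is null by Rademacher, and a Lipschitz map sends it to a
  -- Hausdorff-null set.
  have hνD : ν Dᶜ = 0 := by
    rw [hν, hemb.comap_apply, ← nonpos_iff_eq_zero]
    have := euclideanHausdorffMeasure_image_le_of_edist_le m (1 + K) (f := f) (g := id) (S := Dᶜ)
      (fun x _ y _ => (hf.lipschitzWith hγ) x y)
    rwa [Set.image_id, hm, InnerProductSpace.euclideanHausdorffMeasure_eq_volume, hD0,
      mul_zero] at this
  have hgD : graphAreaMeasure γ Dᶜ = 0 :=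
    (withDensity_absolutelyContinuous _ _) hD0
  have hred : ∀ (μ : Measure F), μ Dᶜ = 0 → ∀ S, μ S = μ (S ∩ D) := by
    intro μ hμ S
    rw [measure_inter_conull hμ]
  have hlim : Tendsto (fun κ : ℝ≥0 => (κ : ℝ≥0∞) ^ (m + 1)) (𝓝[>] 1) (𝓝 1) := by
    have : Continuous fun κ : ℝ≥0 => (κ : ℝ≥0∞) ^ (m + 1) := by fun_prop
    have := (this.tendsto 1).mono_left (nhdsWithin_le_nhds (s := Set.Ioi 1))
    simpa using this
  ext S hS
  rw [hred _ hνD, hred _ hgD]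
  have hcmp := fun (κ : ℝ≥0) (hκ : 1 < κ) =>
    hf.measure_image_comparable hγ hκ (hS.inter hDm) fun y hy => hy.2
  apply le_antisymm
  · have := ENNReal.Tendsto.mul_const (b := graphAreaMeasure γ (S ∩ D)) hlim (Or.inl one_ne_zero)
    rw [one_mul] at this
    refine ge_of_tendsto this ?_
    filter_upwards [self_mem_nhdsWithin] with κ hκ
    exact (hcmp κ hκ).1
  · have := ENNReal.Tendsto.mul_const (b := ν (S ∩ D)) hlim (Or.inl one_ne_zero)
    rw [one_mul] at this
    refine ge_of_tendsto this ?_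
    filter_upwards [self_mem_nhdsWithin] with κ hκ
    exact (hcmp κ hκ).2

theorem IsGraphMap.lintegral_range {f : F → X} {γ : F → ℝ} (hf : IsGraphMap f γ)
    {K : ℝ≥0} (hγ : LipschitzWith K γ) {φ : X → ℝ≥0∞} (hφ : Measurable φ) :
    ∫⁻ x in Set.range f, φ x ∂(Measure.euclideanHausdorffMeasure (Module.finrank ℝ F)) =
      ∫⁻ y, ENNReal.ofReal (areaElement (fderiv ℝ γ y)) * φ (f y) := by
  have hemb := hf.measurableEmbedding hγ
  rw [← hemb.map_comap, hemb.lintegral_map, hf.comap_euclideanHausdorffMeasure hγ,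
    graphAreaMeasure]
  exact lintegral_withDensity_eq_lintegral_mul _
    (measurable_areaElement_fderiv γ).ennreal_ofReal (hφ.comp hemb.measurable)

end AreaFormula

/-! ### Collars of Lipschitz subgraphs -/

section LocalMinkowski

open scoped ENNReal NNReal

/-- The points above the graph of `γ` at distance less than `r` from the subgraph. -/
def subgraphCollar {F : Type*} [NormedAddCommGroup F] (γ : F → ℝ) (r : ℝ) : Set (F × ℝ) :=
  {q | γ q.1 ≤ q.2 ∧ ∃ z s, s ≤ γ z ∧ ‖q.1 - z‖ ^ 2 + (q.2 - s) ^ 2 < r ^ 2}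

section Slices

variable {F : Type*} [NormedAddCommGroup F] {γ : F → ℝ} {r : ℝ} {y : F} {t : ℝ}

theorem measurableSet_subgraphCollar_slice (γ : F → ℝ) (r : ℝ) (y : F) :
    MeasurableSet {t | (y, t) ∈ subgraphCollar γ r} := by
  have : {t | (y, t) ∈ subgraphCollar γ r} =
      Set.Ici (γ y) ∩ ⋃ z, ⋃ s, ⋃ (_ : s ≤ γ z), {t | ‖y - z‖ ^ 2 + (t - s) ^ 2 < r ^ 2} := by
    ext t
    simp [subgraphCollar]
  rw [this]
  refine measurableSet_Ici.inter (IsOpen.measurableSet ?_)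
  refine isOpen_iUnion fun z => isOpen_iUnion fun s => isOpen_iUnion fun _ => ?_
  exact isOpen_lt (by fun_prop) continuous_const

/-- This crude bound is uniform in `y`; it provides the dominating function for the passage to the
limit. -/
theorem subgraphCollar_slice_subset_of_lipschitz {K : ℝ≥0} (hγ : LipschitzWith K γ) (hr : 0 < r) :
    {t | (y, t) ∈ subgraphCollar γ r} ⊆ Set.Ico (γ y) (γ y + r * (K + 1)) := by
  rintro t ⟨h1, z, s, hs, h⟩
  refine ⟨h1, ?_⟩
  have h2 : ‖y - z‖ < r := by
    apply lt_of_pow_lt_pow_left₀ 2 hr.le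
    nlinarith [sq_nonneg (t - s)]
  have h3 : t - s < r := by
    apply lt_of_pow_lt_pow_left₀ 2 hr.le
    nlinarith [sq_nonneg ‖y - z‖]
  have h4 := hγ.dist_le_mul z y
  rw [Real.dist_eq, dist_comm, dist_eq_norm] at h4
  have h5 := le_abs_self (γ z - γ y)
  have h6 : (K : ℝ) * ‖y - z‖ ≤ K * r := by gcongr
  linarith

variable [InnerProductSpace ℝ F]

/-- By Cauchy–Schwarz, `‖p‖ ‖w‖ + (t - s) ≤ √(1 + ‖p‖²) √(‖w‖² + (t - s)²)`, which is less than `r`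
times the area element; `η` pays for the linearization error. -/
theorem subgraphCollar_slice_subset {p : F →L[ℝ] ℝ} {η : ℝ} (hη : 0 < η) (hr : 0 < r)
    (hp : ∀ w, ‖w‖ < r → |γ (y + w) - γ y - p w| ≤ η * ‖w‖) :
    {t | (y, t) ∈ subgraphCollar γ r} ⊆ Set.Ico (γ y) (γ y + r * (areaElement p + η)) := by
  rintro t ⟨h1, z, s, hs, h⟩
  refine ⟨h1, ?_⟩
  simp only at h
  obtain ⟨w, rfl⟩ : ∃ w, z = y + w := ⟨z - y, by abel⟩
  rw [sub_add_cancel_left, norm_neg] at h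
  have h2 : ‖w‖ < r := by
    apply lt_of_pow_lt_pow_left₀ 2 hr.le
    nlinarith [sq_nonneg (t - s)]
  have h3 := (abs_le.1 (hp w h2)).2
  have h4 : p w ≤ ‖p‖ * ‖w‖ := (le_abs_self _).trans (p.le_opNorm w)
  have hc2 := areaElement_sq p
  have hc := one_le_areaElement p
  have h5 : ‖p‖ * ‖w‖ + (t - s) < areaElement p * r := by
    apply lt_of_pow_lt_pow_left₀ 2 (by positivity)
    have : (‖p‖ * ‖w‖ + (t - s)) ^ 2 ≤ (1 + ‖p‖ ^ 2) * (‖w‖ ^ 2 + (t - s) ^ 2) := by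
      nlinarith [sq_nonneg (‖w‖ - ‖p‖ * (t - s))]
    rw [mul_pow, hc2]
    refine this.trans_lt ?_
    gcongr
  nlinarith

theorem subset_subgraphCollar_slice [CompleteSpace F] {p : F →L[ℝ] ℝ} {η : ℝ} (hη : 0 < η)
    (hr : 0 < r) (hp : ∀ w, ‖w‖ < r → |γ (y + w) - γ y - p w| ≤ η * ‖w‖) :
    Set.Ico (γ y) (γ y + r * (areaElement p - η)) ⊆ {t | (y, t) ∈ subgraphCollar γ r} := by
  rintro t ⟨h1, h2⟩
  refine ⟨h1, ?_⟩
  simp only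
  set c := areaElement p with hcdef
  have hc2 : c ^ 2 = 1 + ‖p‖ ^ 2 := areaElement_sq p
  have hc : 1 ≤ c := one_le_areaElement p
  have hc0 : 0 < c := by positivity
  set v : F := (InnerProductSpace.toDual ℝ F).symm p with hv
  have hnv : ‖v‖ = ‖p‖ := by simp [hv]
  have hpv : p v = ‖p‖ ^ 2 := by
    rw [← hnv, ← real_inner_self_eq_norm_sq]
    exact InnerProductSpace.toDual_symm_apply.symm
  have hnc : ‖p‖ < c := by
    apply lt_of_pow_lt_pow_left₀ 2 hc0.le
    linarith
  have hnw : ‖(r / c) • v‖ = r * (‖p‖ / c) := by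
    rw [norm_smul, hnv, Real.norm_of_nonneg (by positivity)]; ring
  have hq : ‖p‖ / c < 1 := (div_lt_one hc0).2 hnc
  have hwr : ‖(r / c) • v‖ < r := by rw [hnw]; nlinarith
  have h3 := (abs_le.1 (hp _ hwr)).1
  rw [map_smul, hpv, hnw, smul_eq_mul] at h3
  -- The displacement is the equality case of Cauchy–Schwarz: horizontal length `r ‖p‖ / c` along
  -- the gradient and height `r / c`. The minimum covers the case where `t` is already below the
  -- graph over the shifted point.
  refine ⟨y + (r / c) • v, min t (γ (y + (r / c) • v)), min_le_right _ _, ?_⟩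
  rw [sub_add_cancel_left, norm_neg, hnw]
  have hid : (‖p‖ / c) ^ 2 + (1 / c) ^ 2 = 1 := by
    field_simp; linarith
  have hid2 : r / c * ‖p‖ ^ 2 = r * c - r * (1 / c) := by
    field_simp; linarith
  have h0 : 0 ≤ t - min t (γ (y + (r / c) • v)) := sub_nonneg.2 (min_le_left _ _)
  have hlt : t - min t (γ (y + (r / c) • v)) < r * (1 / c) := by
    rcases le_total t (γ (y + (r / c) • v)) with h | h
    · rw [min_eq_left h, sub_self]; positivity
    · rw [min_eq_right h]
      have : η * (r * (‖p‖ / c)) ≤ η * r := by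
        have : r * (‖p‖ / c) ≤ r := by nlinarith
        gcongr
      nlinarith
  have := mul_self_lt_mul_self h0 hlt
  nlinarith

end Slices

theorem ENNReal.tendsto_ofReal_mul_of_forall {ι : Type*} {l : Filter ι} {u : ι → ℝ≥0∞} {c ψ : ℝ}
    (h : ∀ η ∈ Set.Ioo (0 : ℝ) 1, ∀ᶠ i in l, ENNReal.ofReal ((c - η) * (ψ - η)) ≤ u i ∧
      u i ≤ ENNReal.ofReal ((c + η) * (ψ + η))) :
    Tendsto u l (𝓝 (ENNReal.ofReal (c * ψ))) := by
  have hlow : Tendsto (fun η : ℝ => ENNReal.ofReal ((c - η) * (ψ - η))) (𝓝[>] 0)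
      (𝓝 (ENNReal.ofReal (c * ψ))) := by
    have : Continuous fun η : ℝ => ENNReal.ofReal ((c - η) * (ψ - η)) :=
      ENNReal.continuous_ofReal.comp (by fun_prop)
    simpa using (this.tendsto 0).mono_left nhdsWithin_le_nhds
  have hup : Tendsto (fun η : ℝ => ENNReal.ofReal ((c + η) * (ψ + η))) (𝓝[>] 0)
      (𝓝 (ENNReal.ofReal (c * ψ))) := by
    have : Continuous fun η : ℝ => ENNReal.ofReal ((c + η) * (ψ + η)) :=
      ENNReal.continuous_ofReal.comp (by fun_prop)
    simpa using (this.tendsto 0).mono_left nhdsWithin_le_nhds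
  have hη : ∀ᶠ η : ℝ in 𝓝[>] 0, η ∈ Set.Ioo (0 : ℝ) 1 := Ioo_mem_nhdsGT one_pos
  rw [tendsto_order]
  constructor
  · intro a ha
    obtain ⟨η, h1, h2⟩ := ((hlow.eventually (lt_mem_nhds ha)).and hη).exists
    filter_upwards [h η h2] with i hi using h1.trans_le hi.1
  · intro a ha
    obtain ⟨η, h1, h2⟩ := ((hup.eventually (gt_mem_nhds ha)).and hη).exists
    filter_upwards [h η h2] with i hi using hi.2.trans_lt h1

/-- For small `r` the slice is squeezed between intervals of length `r (c ± η)` starting at `γ y`,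
on which `ψ` stays within `η` of `ψ (γ y)`. -/
theorem tendsto_lintegral_subgraphCollar_slice {F : Type*} [NormedAddCommGroup F]
    [InnerProductSpace ℝ F] [CompleteSpace F] {γ : F → ℝ} {y : F} (hd : DifferentiableAt ℝ γ y)
    {ψ : ℝ → ℝ} (hψ : Continuous ψ) (hψ0 : ∀ t, 0 ≤ ψ t) :
    Tendsto (fun r : ℝ => (∫⁻ t in {t | (y, t) ∈ subgraphCollar γ r}, ENNReal.ofReal (ψ t)) /
      ENNReal.ofReal r) (𝓝[>] 0)
      (𝓝 (ENNReal.ofReal (areaElement (fderiv ℝ γ y) * ψ (γ y)))) := by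
  set p := fderiv ℝ γ y
  set c := areaElement p
  have hc : 1 ≤ c := one_le_areaElement p
  apply ENNReal.tendsto_ofReal_mul_of_forall
  rintro η ⟨hη, hη1⟩
  obtain ⟨ρ, hρ, hp⟩ : ∃ ρ > 0, ∀ w : F, ‖w‖ < ρ → |γ (y + w) - γ y - p w| ≤ η * ‖w‖ := by
    have h1 := (hasFDerivAt_iff_isLittleO_nhds_zero.1 hd.hasFDerivAt).def hη
    obtain ⟨ρ, hρ, h⟩ := Metric.eventually_nhds_iff.1 h1
    exact ⟨ρ, hρ, fun w hw => by simpa using h (y := w) (by simpa using hw)⟩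
  obtain ⟨σ, hσ, hs⟩ := Metric.continuousAt_iff.1 (hψ.continuousAt (x := γ y)) η hη
  have hev : ∀ᶠ r : ℝ in 𝓝[>] 0, r ∈ Set.Ioo 0 (min ρ (σ / (c + η))) :=
    Ioo_mem_nhdsGT (by positivity)
  filter_upwards [hev] with r ⟨hr, hr'⟩
  have hrρ : r < ρ := hr'.trans_le (min_le_left _ _)
  have hrσ : r * (c + η) < σ := by
    rw [← lt_div_iff₀ (by positivity)]
    exact hr'.trans_le (min_le_right _ _)
  have hp' : ∀ w, ‖w‖ < r → |γ (y + w) - γ y - p w| ≤ η * ‖w‖ := fun w hw => hp w (hw.trans hrρ)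
  have hsub : {t | (y, t) ∈ subgraphCollar γ r} ⊆ Set.Ico (γ y) (γ y + r * (c + η)) :=
    subgraphCollar_slice_subset hη hr hp'
  have hsup : Set.Ico (γ y) (γ y + r * (c - η)) ⊆ {t | (y, t) ∈ subgraphCollar γ r} :=
    subset_subgraphCollar_slice hη hr hp'
  set T := {t | (y, t) ∈ subgraphCollar γ r}
  have hTm : MeasurableSet T := measurableSet_subgraphCollar_slice γ r y
  have hval : ∀ t ∈ T, ψ (γ y) - η ≤ ψ t ∧ ψ t ≤ ψ (γ y) + η := by
    intro t ht
    have h1 := hsub ht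
    have h2 := hs (x := t) (by
      rw [Real.dist_eq, abs_of_nonneg (by linarith [h1.1])]
      linarith [h1.2])
    rw [Real.dist_eq, abs_lt] at h2
    constructor <;> linarith
  have hr0 : ENNReal.ofReal r ≠ 0 := by simpa using hr
  constructor
  · rw [ENNReal.le_div_iff_mul_le (Or.inl hr0) (Or.inl ENNReal.ofReal_ne_top)]
    calc ENNReal.ofReal ((c - η) * (ψ (γ y) - η)) * ENNReal.ofReal r
        = ENNReal.ofReal (ψ (γ y) - η) * ENNReal.ofReal (r * (c - η)) := by
          rw [mul_comm, ← ENNReal.ofReal_mul hr.le, mul_comm (ENNReal.ofReal (ψ (γ y) - η)),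
            ← ENNReal.ofReal_mul (mul_nonneg hr.le (by linarith))]
          ring_nf
      _ ≤ ENNReal.ofReal (ψ (γ y) - η) * volume T := by
          gcongr
          refine le_trans ?_ (measure_mono hsup)
          rw [Real.volume_Ico]
          apply le_of_eq; ring_nf
      _ = ∫⁻ _ in T, ENNReal.ofReal (ψ (γ y) - η) := by simp
      _ ≤ _ := setLIntegral_mono' hTm fun t ht => ENNReal.ofReal_le_ofReal (hval t ht).1
  · apply ENNReal.div_le_of_le_mul
    calc _ ≤ ∫⁻ _ in T, ENNReal.ofReal (ψ (γ y) + η) :=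
          setLIntegral_mono' hTm fun t ht => ENNReal.ofReal_le_ofReal (hval t ht).2
      _ = ENNReal.ofReal (ψ (γ y) + η) * volume T := by simp
      _ ≤ ENNReal.ofReal (ψ (γ y) + η) * ENNReal.ofReal (r * (c + η)) := by
          gcongr
          refine (measure_mono hsub).trans ?_
          rw [Real.volume_Ico]
          apply le_of_eq; ring_nf
      _ = _ := by
          rw [← ENNReal.ofReal_mul (by linarith [hψ0 (γ y)]),
            ← ENNReal.ofReal_mul (mul_nonneg (by linarith) (by linarith [hψ0 (γ y)]))]
          ring_nf

/-- Minkowski content of a Lipschitz subgraph, weighted by a compactly supported function. -/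
theorem tendsto_lintegral_subgraph {F E : Type*} [NormedAddCommGroup F]
    [InnerProductSpace ℝ F] [FiniteDimensional ℝ F] [MeasurableSpace F] [BorelSpace F]
    [MetricSpace E] [MeasureSpace E] [BorelSpace E]
    {Φ : F × ℝ → E} (hΦ : MeasurePreserving Φ volume volume) (hΦc : Continuous Φ)
    (hdist : ∀ p q, dist (Φ p) (Φ q) ^ 2 = ‖p.1 - q.1‖ ^ 2 + (p.2 - q.2) ^ 2)
    {γ : F → ℝ} {K : ℝ≥0} (hγ : LipschitzWith K γ)
    {φ : E → ℝ} (hφ : Continuous φ) (hφ0 : ∀ x, 0 ≤ φ x) {M ρ : ℝ} (hM : ∀ x, φ x ≤ M)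
    (hρ : ∀ x, φ x ≠ 0 → dist x (Φ (0, 0)) ≤ ρ)
    {V : ℝ → Set E} (hV : ∀ r, MeasurableSet (V r))
    (hVN : ∀ᶠ r in 𝓝[>] (0 : ℝ), ∀ q, φ (Φ q) ≠ 0 → (Φ q ∈ V r ↔ q ∈ subgraphCollar γ r)) :
    Tendsto (fun r : ℝ => (∫⁻ x in V r, ENNReal.ofReal (φ x)) / ENNReal.ofReal r) (𝓝[>] 0)
      (𝓝 (∫⁻ x in Set.range (fun y => Φ (y, γ y)), ENNReal.ofReal (φ x)
        ∂(Measure.euclideanHausdorffMeasure (Module.finrank ℝ F)))) := by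
  have hgraph : IsGraphMap (fun y => Φ (y, γ y)) γ := fun y z => hdist _ _
  have hφm : Measurable fun x => ENNReal.ofReal (φ x) := hφ.measurable.ennreal_ofReal
  rw [hgraph.lintegral_range hγ hφm]
  have hind : ∀ r, Measurable fun q : F × ℝ =>
      (V r).indicator (fun x => ENNReal.ofReal (φ x)) (Φ q) :=
    fun r => (hφm.indicator (hV r)).comp hΦ.measurable
  have heq : ∀ r, (∫⁻ x in V r, ENNReal.ofReal (φ x)) / ENNReal.ofReal r =
      ∫⁻ y, (∫⁻ t, (V r).indicator (fun x => ENNReal.ofReal (φ x)) (Φ (y, t))) *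
        (ENNReal.ofReal r)⁻¹ := by
    intro r
    rw [← lintegral_indicator (hV r), ← hΦ.lintegral_comp (hφm.indicator (hV r)),
      Measure.volume_eq_prod, lintegral_prod _ (hind r).aemeasurable,
      lintegral_mul_const _ (hind r).lintegral_prod_right', div_eq_mul_inv]
  have hinner : ∀ᶠ r in 𝓝[>] (0 : ℝ), ∀ y,
      (∫⁻ t, (V r).indicator (fun x => ENNReal.ofReal (φ x)) (Φ (y, t))) * (ENNReal.ofReal r)⁻¹ =
      (∫⁻ t in {t | (y, t) ∈ subgraphCollar γ r}, ENNReal.ofReal (φ (Φ (y, t)))) /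
        ENNReal.ofReal r := by
    filter_upwards [hVN] with r hr y
    rw [← lintegral_indicator (measurableSet_subgraphCollar_slice γ r y), div_eq_mul_inv]
    congr 2
    ext t
    by_cases h0 : φ (Φ (y, t)) = 0
    · simp [Set.indicator, h0]
    · have := hr (y, t) h0
      by_cases hm : (y, t) ∈ subgraphCollar γ r
      · rw [Set.indicator_of_mem (this.2 hm), Set.indicator_of_mem (by exact hm)]
      · rw [Set.indicator_of_notMem (mt this.1 hm), Set.indicator_of_notMem (by exact hm)]
  simp_rw [heq]
  -- After Fubini, dominated convergence in `y`: the quotients are at most `M (K + 1)`, vanish for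
  -- `‖y‖ > ρ`, and converge wherever `γ` is differentiable.
  refine tendsto_lintegral_filter_of_dominated_convergence
    ((Metric.closedBall (0 : F) ρ).indicator fun _ => ENNReal.ofReal (M * (K + 1)))
    (Eventually.of_forall fun r => (hind r).lintegral_prod_right'.mul_const _) ?_ ?_ ?_
  · filter_upwards [hinner, self_mem_nhdsWithin] with r hr (hr0 : 0 < r)
    refine Eventually.of_forall fun y => ?_
    rw [hr y]
    by_cases hy : y ∈ Metric.closedBall (0 : F) ρ
    · rw [Set.indicator_of_mem hy]
      apply ENNReal.div_le_of_le_mul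
      have hM0 : 0 ≤ M := (hφ0 (Φ (y, 0))).trans (hM _)
      calc _ ≤ ∫⁻ _ in {t | (y, t) ∈ subgraphCollar γ r}, ENNReal.ofReal M :=
            lintegral_mono fun t => ENNReal.ofReal_le_ofReal (hM _)
        _ = ENNReal.ofReal M * volume {t | (y, t) ∈ subgraphCollar γ r} := by simp
        _ ≤ ENNReal.ofReal M * volume (Set.Ico (γ y) (γ y + r * (K + 1))) := by
            gcongr
            exact subgraphCollar_slice_subset_of_lipschitz hγ hr0
        _ = _ := by
            rw [Real.volume_Ico, ← ENNReal.ofReal_mul hM0, ← ENNReal.ofReal_mul (by positivity)]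
            ring_nf
    · rw [Set.indicator_of_notMem hy]
      have : ∀ t, φ (Φ (y, t)) = 0 := by
        intro t
        by_contra h
        apply hy
        have h1 := hρ _ h
        have h2 := hdist (y, t) (0, 0)
        simp only [sub_zero] at h2
        rw [mem_closedBall_zero_iff]
        refine le_trans ?_ h1
        rw [← pow_le_pow_iff_left₀ (norm_nonneg _) dist_nonneg two_ne_zero]
        nlinarith [sq_nonneg t]
      simp [this]
  · rw [lintegral_indicator measurableSet_closedBall]
    simp only [lintegral_const, Measure.restrict_apply_univ]
    exact ENNReal.mul_ne_top ENNReal.ofReal_ne_top measure_closedBall_lt_top.ne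
  · filter_upwards [hγ.ae_differentiableAt] with y hy
    have h1 := tendsto_lintegral_subgraphCollar_slice hy
      (ψ := fun t => φ (Φ (y, t))) (by fun_prop) (fun t => hφ0 _)
    rw [ENNReal.ofReal_mul (zero_le_one.trans (one_le_areaElement _))] at h1
    refine h1.congr' ?_
    filter_upwards [hinner] with r hr
    exact (hr y).symm

end LocalMinkowski

/-! ### Minkowski content of smooth sets -/

section SmoothSets

open scoped ENNReal NNReal

/-- Coordinates `(y, t) ↦ y + t e` with `y` orthogonal to `e`. -/
def hyperplaneCoord {E : Type*} [NormedAddCommGroup E] [InnerProductSpace ℝ E] (e : E)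
    (q : (Submodule.span ℝ {e})ᗮ × ℝ) : E := (q.1 : E) + q.2 • e

section Coord

variable {E : Type*} [NormedAddCommGroup E] [InnerProductSpace ℝ E] {e : E}

theorem continuous_hyperplaneCoord : Continuous (hyperplaneCoord e) := by
  unfold hyperplaneCoord
  fun_prop

theorem inner_hyperplaneCoord (he : ‖e‖ = 1) (q : (Submodule.span ℝ {e})ᗮ × ℝ) :
    inner ℝ e (hyperplaneCoord e q) = q.2 := by
  have h : inner ℝ e (q.1 : E) = 0 := Submodule.mem_orthogonal_singleton_iff_inner_right.1 q.1.2
  rw [hyperplaneCoord, inner_add_right, h, inner_smul_right, real_inner_self_eq_norm_sq, he]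
  simp

theorem hyperplaneCoord_surjective (he : ‖e‖ = 1) : Function.Surjective (hyperplaneCoord e) := by
  intro x
  refine ⟨(⟨x - (inner ℝ e x : ℝ) • e, ?_⟩, inner ℝ e x), ?_⟩
  · rw [Submodule.mem_orthogonal_singleton_iff_inner_right, inner_sub_right, inner_smul_right,
      real_inner_self_eq_norm_sq, he]
    simp
  · simp [hyperplaneCoord]

theorem norm_hyperplaneCoord_sq (he : ‖e‖ = 1) (q : (Submodule.span ℝ {e})ᗮ × ℝ) :
    ‖hyperplaneCoord e q‖ ^ 2 = ‖q.1‖ ^ 2 + q.2 ^ 2 := by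
  have h : inner ℝ (q.1 : E) e = 0 := Submodule.mem_orthogonal_singleton_iff_inner_left.1 q.1.2
  rw [hyperplaneCoord, norm_add_sq_real, inner_smul_right, h, norm_smul, he]
  simp

theorem dist_hyperplaneCoord_sq (he : ‖e‖ = 1) (p q : (Submodule.span ℝ {e})ᗮ × ℝ) :
    dist (hyperplaneCoord e p) (hyperplaneCoord e q) ^ 2 =
      ‖p.1 - q.1‖ ^ 2 + (p.2 - q.2) ^ 2 := by
  rw [← Prod.fst_sub, ← Prod.snd_sub, ← norm_hyperplaneCoord_sq he, dist_eq_norm]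
  congr 2
  simp only [hyperplaneCoord, Prod.fst_sub, Prod.snd_sub, Submodule.coe_sub, sub_smul]
  abel

theorem finrank_orthogonal_span_singleton_add_one [FiniteDimensional ℝ E] (he : ‖e‖ = 1) :
    Module.finrank ℝ (Submodule.span ℝ {e})ᗮ + 1 = Module.finrank ℝ E := by
  have h0 : e ≠ 0 := by rintro rfl; simp at he
  rw [← Submodule.finrank_add_finrank_orthogonal (Submodule.span ℝ {e}), finrank_span_singleton h0,
    add_comm]

theorem measurePreserving_hyperplaneCoord [FiniteDimensional ℝ E] [MeasurableSpace E]
    [BorelSpace E] (he : ‖e‖ = 1) :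
    MeasurePreserving (hyperplaneCoord e) volume volume := by
  let L : WithLp 2 ((Submodule.span ℝ {e})ᗮ × ℝ) →ₗᵢ[ℝ] E :=
    { toFun := fun q => hyperplaneCoord e (WithLp.ofLp q)
      map_add' := by
        intro p q
        simp only [hyperplaneCoord, WithLp.ofLp_add, Prod.fst_add, Prod.snd_add,
          Submodule.coe_add, add_smul]
        abel
      map_smul' := by
        intro c q
        simp [hyperplaneCoord, smul_smul]
      norm_map' := by
        intro q
        rw [← sq_eq_sq₀ (norm_nonneg _) (norm_nonneg _), WithLp.prod_norm_sq_eq_of_L2]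
        have := norm_hyperplaneCoord_sq he (WithLp.ofLp q)
        rw [Real.norm_eq_abs, sq_abs]
        exact this }
  have hfin : Module.finrank ℝ (WithLp 2 ((Submodule.span ℝ {e})ᗮ × ℝ)) = Module.finrank ℝ E := by
    rw [(WithLp.linearEquiv 2 ℝ _).finrank_eq, Module.finrank_prod, Module.finrank_self,
      finrank_orthogonal_span_singleton_add_one he]
  have h1 := (L.toLinearIsometryEquiv hfin).measurePreserving
  exact h1.comp (WithLp.volume_preserving_toLp (Submodule.span ℝ {e})ᗮ ℝ)

end Coord

variable {n : ℕ}

/-- The support of `φ` lies in the half-size ball, so for `r < ε / 2` every point within `r` of it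
stays in the ball where `M` is a subgraph; there the collar of `M` is the model collar. -/
theorem tendsto_lintegral_collar_of_local_graph
    {M : Set (EuclideanSpace ℝ (Fin n))} {x₀ e : EuclideanSpace ℝ (Fin n)}
    {g : EuclideanSpace ℝ (Fin n) → ℝ} {K : ℝ≥0} {ε : ℝ} (hM : IsOpen M) (hε : 0 < ε)
    (he : ‖e‖ = 1) (hg : LipschitzWith K g)
    (h : ∀ x ∈ Metric.ball x₀ ε,
          (x ∈ frontier M ↔ inner ℝ e x = g (x - (inner ℝ e x : ℝ) • e)) ∧
          (x ∈ M ↔ inner ℝ e x < g (x - (inner ℝ e x : ℝ) • e)))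
    {φ : EuclideanSpace ℝ (Fin n) → ℝ} (hφ : Continuous φ) (hφ0 : ∀ x, 0 ≤ φ x)
    (hsupp : ∀ x, φ x ≠ 0 → x ∈ Metric.ball x₀ (ε / 2)) :
    Tendsto (fun r : ℝ => (∫⁻ x in Metric.thickening r M \ M, ENNReal.ofReal (φ x)) /
        ENNReal.ofReal r) (𝓝[>] 0)
      (𝓝 (∫⁻ x in frontier M, ENNReal.ofReal (φ x)
        ∂(Measure.euclideanHausdorffMeasure (n - 1)))) := by
  set H := (Submodule.span ℝ {e})ᗮ
  have hn : Module.finrank ℝ H = n - 1 := by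
    have := finrank_orthogonal_span_singleton_add_one he
    rw [finrank_euclideanSpace_fin] at this
    exact Nat.eq_sub_of_add_eq this
  set γ : H → ℝ := fun y => g (y : EuclideanSpace ℝ (Fin n)) with hγdef
  have hγ : LipschitzWith K γ := by
    have := hg.comp (LipschitzWith.subtype_val (H : Set (EuclideanSpace ℝ (Fin n))))
    rwa [mul_one] at this
  have hloc : ∀ q : H × ℝ, hyperplaneCoord e q ∈ Metric.ball x₀ ε →
      (hyperplaneCoord e q ∈ frontier M ↔ q.2 = γ q.1) ∧
      (hyperplaneCoord e q ∈ M ↔ q.2 < γ q.1) := by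
    intro q hq
    have := h _ hq
    rwa [inner_hyperplaneCoord he, show hyperplaneCoord e q - q.2 • e = q.1 by
      simp [hyperplaneCoord]] at this
  have hcl : ∀ q : H × ℝ, hyperplaneCoord e q ∈ Metric.ball x₀ ε →
      (hyperplaneCoord e q ∈ closure M ↔ q.2 ≤ γ q.1) := by
    intro q hq
    rw [closure_eq_self_union_frontier, Set.mem_union, (hloc q hq).1, (hloc q hq).2, le_iff_lt_or_eq]
  have hdist := dist_hyperplaneCoord_sq he
  have hVN : ∀ᶠ r in 𝓝[>] (0 : ℝ), ∀ q : H × ℝ, φ (hyperplaneCoord e q) ≠ 0 →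
      (hyperplaneCoord e q ∈ Metric.thickening r M \ M ↔ q ∈ subgraphCollar γ r) := by
    filter_upwards [Ioo_mem_nhdsGT (half_pos hε)] with r ⟨hr0, hr⟩ q hq
    have hq1 := Metric.mem_ball.1 (hsupp _ hq)
    have hq2 : hyperplaneCoord e q ∈ Metric.ball x₀ ε := Metric.mem_ball.2 (by linarith)
    -- Thickening `M` or its closure gives the same set; the closure matches the non-strict `s ≤ γ
    -- z` in the model collar.
    rw [Set.mem_sdiff, (hloc q hq2).2, not_lt, and_comm, subgraphCollar, Set.mem_ofPred_eq,
      ← Metric.thickening_closure, Metric.mem_thickening_iff]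
    have hlt : ∀ p, dist (hyperplaneCoord e q) (hyperplaneCoord e p) < r ↔
        ‖q.1 - p.1‖ ^ 2 + (q.2 - p.2) ^ 2 < r ^ 2 := by
      intro p
      rw [← hdist, pow_lt_pow_iff_left₀ dist_nonneg hr0.le two_ne_zero]
    have hpb : ∀ p, dist (hyperplaneCoord e q) (hyperplaneCoord e p) < r →
        hyperplaneCoord e p ∈ Metric.ball x₀ ε := by
      intro p hp
      have := dist_triangle_left (hyperplaneCoord e p) x₀ (hyperplaneCoord e q)
      rw [Metric.mem_ball]
      linarith
    refine and_congr_right fun _ => ?_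
    constructor
    · rintro ⟨z, hz, hzr⟩
      obtain ⟨p, rfl⟩ := hyperplaneCoord_surjective he z
      exact ⟨p.1, p.2, (hcl p (hpb p hzr)).1 hz, (hlt p).1 hzr⟩
    · rintro ⟨z, s, hs, hzr⟩
      have hzr' := (hlt (z, s)).2 hzr
      exact ⟨_, (hcl (z, s) (hpb _ hzr')).2 hs, hzr'⟩
  obtain ⟨B, hB⟩ : ∃ B, ∀ x, φ x ≤ B := by
    obtain ⟨B, hB⟩ := (isCompact_closedBall x₀ (ε / 2)).bddAbove_image hφ.continuousOn
    refine ⟨max B 0, fun x => ?_⟩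
    by_cases hx : φ x = 0
    · rw [hx]; exact le_max_right _ _
    · exact le_max_of_le_left (hB ⟨x, Metric.ball_subset_closedBall (hsupp x hx), rfl⟩)
  have key := tendsto_lintegral_subgraph (measurePreserving_hyperplaneCoord he)
    continuous_hyperplaneCoord hdist hγ hφ hφ0 hB
    (ρ := ε / 2 + dist x₀ (hyperplaneCoord e (0, 0)))
    (fun x hx => (dist_triangle _ x₀ _).trans
      (add_le_add (Metric.mem_ball.1 (hsupp x hx)).le le_rfl))
    (fun r => (Metric.isOpen_thickening.measurableSet).diff hM.measurableSet) hVN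
  rw [hn] at key
  convert key using 2
  have hgraph : IsGraphMap (fun y : H => hyperplaneCoord e (y, γ y)) γ := fun y z => hdist _ _
  have hrange : MeasurableSet (Set.range (fun y : H => hyperplaneCoord e (y, γ y))) :=
    (hgraph.measurableEmbedding hγ).measurableSet_range
  rw [← lintegral_indicator isClosed_frontier.measurableSet, ← lintegral_indicator hrange]
  congr 1
  ext x
  by_cases hx : φ x = 0
  · simp [Set.indicator, hx]
  · have hxb : x ∈ Metric.ball x₀ ε :=
      Metric.ball_subset_ball (by linarith) (hsupp x hx)
    have hiff : x ∈ frontier M ↔ x ∈ Set.range (fun y : H => hyperplaneCoord e (y, γ y)) := by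
      obtain ⟨p, rfl⟩ := hyperplaneCoord_surjective he x
      rw [(hloc p hxb).1]
      constructor
      · intro hp
        exact ⟨p.1, by simp only [← hp]⟩
      · rintro ⟨y, hy⟩
        have h1 := hdist (y, γ y) p
        simp only at hy
        rw [hy, dist_self] at h1
        have h2 : ‖y - p.1‖ ^ 2 = 0 := by nlinarith [sq_nonneg ‖y - p.1‖, sq_nonneg (γ y - p.2)]
        have h3 : (γ y - p.2) ^ 2 = 0 := by nlinarith [sq_nonneg ‖y - p.1‖, sq_nonneg (γ y - p.2)]
        have h4 : y = p.1 := sub_eq_zero.1 (norm_eq_zero.1 (pow_eq_zero_iff two_ne_zero |>.1 h2))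
        have h5 := pow_eq_zero_iff two_ne_zero |>.1 h3
        rw [← h4]
        linarith
    by_cases hm : x ∈ frontier M
    · rw [Set.indicator_of_mem hm, Set.indicator_of_mem (hiff.1 hm)]
    · rw [Set.indicator_of_notMem hm, Set.indicator_of_notMem (mt hiff.2 hm)]

theorem thickening_diff_subset_cthickening_frontier {E : Type*} [NormedAddCommGroup E]
    [NormedSpace ℝ E] [FiniteDimensional ℝ E] (M : Set E) (r : ℝ) :
    Metric.thickening r M \ M ⊆ Metric.cthickening r (frontier M) := by
  rintro x ⟨hx, hxM⟩
  obtain ⟨z, hz, hzr⟩ := Metric.mem_thickening_iff.1 hx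
  have hne : Mᶜ ≠ Set.univ := by
    intro h
    have : z ∈ Mᶜ := h ▸ Set.mem_univ z
    exact this hz
  obtain ⟨y, hy, hxy⟩ := exists_mem_frontier_infDist_compl_eq_dist (s := Mᶜ) hxM hne
  rw [frontier_compl] at hy
  rw [compl_compl] at hxy
  refine Metric.mem_cthickening_of_dist_le x y r _ hy ?_
  rw [← hxy]
  exact (Metric.infDist_le_dist_of_mem hz).trans hzr.le

/-- Weighted outer Minkowski content of a smooth set. -/
theorem IsSmoothSet.tendsto_lintegral_collar {M : Set (EuclideanSpace ℝ (Fin n))}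
    (hM : IsSmoothSet M) {φ : EuclideanSpace ℝ (Fin n) → ℝ} (hφ : Continuous φ)
    (hφ0 : ∀ x, 0 ≤ φ x) :
    Tendsto (fun r : ℝ => (∫⁻ x in Metric.thickening r M \ M, ENNReal.ofReal (φ x)) /
        ENNReal.ofReal r) (𝓝[>] 0)
      (𝓝 (∫⁻ x in frontier M, ENNReal.ofReal (φ x)
        ∂(Measure.euclideanHausdorffMeasure (n - 1)))) := by
  obtain ⟨hbdd, hopen, ε, hε, hloc⟩ := hM
  have hfr : Bornology.IsBounded (frontier M) := hbdd.closure.subset frontier_subset_closure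
  -- This compact set contains the frontier and all collars with `r < ε / 4`, so a partition of
  -- unity summing to 1 on it is enough.
  set s := Metric.cthickening (ε / 4) (frontier M) with hs
  have hsc : IsCompact s :=
    Metric.isCompact_of_isClosed_isBounded Metric.isClosed_cthickening hfr.cthickening
  have hcov : s ⊆ ⋃ c : frontier M, Metric.ball (c : EuclideanSpace ℝ (Fin n)) (ε / 2) := by
    intro x hx
    have hx' : x ∈ Metric.thickening (ε / 2) (frontier M) :=
      Metric.cthickening_subset_thickening' (half_pos hε) (by linarith) _ hx
    obtain ⟨z, hz, hzr⟩ := Metric.mem_thickening_iff.1 hx'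
    exact Set.mem_iUnion.2 ⟨⟨z, hz⟩, hzr⟩
  obtain ⟨T, hT⟩ := hsc.elim_finite_subcover _ (fun _ => Metric.isOpen_ball) hcov
  obtain ⟨f, hf⟩ := PartitionOfUnity.exists_isSubordinate (s := s) hsc.isClosed
    (fun c : T => Metric.ball ((c : frontier M) : EuclideanSpace ℝ (Fin n)) (ε / 2))
    (fun _ => Metric.isOpen_ball) (by
      intro x hx
      obtain ⟨c, hc, hxc⟩ := Set.mem_iUnion₂.1 (hT hx)
      exact Set.mem_iUnion.2 ⟨⟨c, hc⟩, hxc⟩)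
  have hpart : ∀ x ∈ s, ENNReal.ofReal (φ x) = ∑ c : T, ENNReal.ofReal (f c x * φ x) := by
    intro x hx
    rw [← ENNReal.ofReal_sum_of_nonneg fun c _ => mul_nonneg (f.nonneg c x) (hφ0 x),
      ← Finset.sum_mul, ← finsum_eq_sum_of_fintype, f.sum_eq_one hx, one_mul]
  have hmeas : ∀ c : T, Measurable fun x => ENNReal.ofReal (f c x * φ x) := fun c =>
    ((f c).continuous.mul hφ).measurable.ennreal_ofReal
  have hsum : ∀ (μ : Measure (EuclideanSpace ℝ (Fin n))) (A : Set (EuclideanSpace ℝ (Fin n))),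
      MeasurableSet A → A ⊆ s → ∫⁻ x in A, ENNReal.ofReal (φ x) ∂μ =
        ∑ c : T, ∫⁻ x in A, ENNReal.ofReal (f c x * φ x) ∂μ := by
    intro μ A hA hAs
    rw [← lintegral_finsetSum _ fun c _ => hmeas c]
    exact setLIntegral_congr_fun hA fun x hx => hpart x (hAs hx)
  have key : Tendsto (fun r : ℝ => ∑ c : T,
      (∫⁻ x in Metric.thickening r M \ M, ENNReal.ofReal (f c x * φ x)) / ENNReal.ofReal r)
      (𝓝[>] 0) (𝓝 (∑ c : T, ∫⁻ x in frontier M, ENNReal.ofReal (f c x * φ x)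
        ∂(Measure.euclideanHausdorffMeasure (n - 1)))) := by
    refine tendsto_finsetSum _ fun c _ => ?_
    obtain ⟨e, g, K, he, hg, h⟩ := hloc (c : frontier M) (c : frontier M).2
    refine tendsto_lintegral_collar_of_local_graph hopen hε he hg h ((f c).continuous.mul hφ)
      (fun x => mul_nonneg (f.nonneg c x) (hφ0 x)) fun x hx => ?_
    exact hf c (subset_tsupport _ (left_ne_zero_of_mul hx))
  rw [← hsum _ _ isClosed_frontier.measurableSet (Metric.self_subset_cthickening _)] at key
  refine key.congr' ?_
  filter_upwards [Ioo_mem_nhdsGT (show 0 < ε / 4 by positivity)] with r ⟨hr0, hr⟩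
  rw [hsum _ _ (Metric.isOpen_thickening.measurableSet.diff hopen.measurableSet)
    ((thickening_diff_subset_cthickening_frontier M r).trans (Metric.cthickening_mono hr.le _))]
  simp_rw [div_eq_mul_inv]
  rw [Finset.sum_mul]

end SmoothSets

/-! ### Polar coordinates and surface measure of spheres -/

section Spheres

open scoped ENNReal NNReal

/-- Integration in polar coordinates. -/
theorem lintegral_eq_lintegral_toSphere {E : Type*} [NormedAddCommGroup E] [NormedSpace ℝ E]
    [FiniteDimensional ℝ E] [Nontrivial E] [MeasurableSpace E] [BorelSpace E]
    (μ : Measure E) [μ.IsAddHaarMeasure] {f : E → ℝ≥0∞} (hf : Measurable f) :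
    ∫⁻ x, f x ∂μ = ∫⁻ θ, ∫⁻ r in Set.Ioi (0 : ℝ),
      ENNReal.ofReal (r ^ (Module.finrank ℝ E - 1)) * f (r • (θ : E)) ∂volume ∂μ.toSphere := by
  have hg : Measurable fun q : Metric.sphere (0 : E) 1 × Set.Ioi (0 : ℝ) =>
      f ((q.2 : ℝ) • (q.1 : E)) := by
    refine hf.comp (Continuous.measurable ?_)
    fun_prop
  calc ∫⁻ x, f x ∂μ = ∫⁻ x : ({(0 : E)}ᶜ : Set E), f x ∂(μ.comap (↑)) := by
        rw [lintegral_subtype_comap (measurableSet_singleton _).compl, restrict_compl_singleton]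
    _ = ∫⁻ q : Metric.sphere (0 : E) 1 × Set.Ioi (0 : ℝ), f ((q.2 : ℝ) • (q.1 : E))
          ∂(μ.toSphere.prod (Measure.volumeIoiPow (Module.finrank ℝ E - 1))) := by
        rw [← μ.measurePreserving_homeomorphUnitSphereProd.lintegral_comp hg]
        refine lintegral_congr fun x => ?_
        have : ‖(x : E)‖ ≠ 0 := norm_ne_zero_iff.2 x.2
        simp [smul_smul, this]
    _ = _ := by
        rw [lintegral_prod _ hg.aemeasurable]
        refine lintegral_congr fun θ => ?_
        have hg' : Measurable fun r : Set.Ioi (0 : ℝ) => f ((r : ℝ) • (θ : E)) :=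
          hf.comp (Continuous.measurable (by fun_prop))
        exact (lintegral_withDensity_eq_lintegral_mul _ (by fun_prop) hg').trans
          (lintegral_subtype_comap measurableSet_Ioi
            fun r : ℝ => ENNReal.ofReal (r ^ (Module.finrank ℝ E - 1)) * f (r • (θ : E)))

variable {n : ℕ}

/-- The difference of squares gives `|A - B| (A + B) = |s - t| (s + t)` for the two roots `A` and
`B`, and `s + t ≤ R ≤ A + B`. -/
theorem abs_sqrt_sub_sqrt_le {R s t : ℝ} (hs : 0 ≤ s) (hs' : s ≤ R / 2)
    (ht : 0 ≤ t) (ht' : t ≤ R / 2) :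
    |√(R ^ 2 - s ^ 2) - √(R ^ 2 - t ^ 2)| ≤ |s - t| := by
  have key : ∀ u, 0 ≤ u → u ≤ R / 2 → R / 2 ≤ √(R ^ 2 - u ^ 2) := by
    intro u hu hu'
    apply Real.le_sqrt_of_sq_le
    nlinarith
  have hsq : ∀ u, 0 ≤ u → u ≤ R / 2 → √(R ^ 2 - u ^ 2) ^ 2 = R ^ 2 - u ^ 2 := fun u hu hu' =>
    Real.sq_sqrt (by nlinarith)
  have h1 := key s hs hs'
  have h2 := key t ht ht'
  have h3 := hsq s hs hs'
  have h4 := hsq t ht ht'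
  generalize √(R ^ 2 - s ^ 2) = A at *
  generalize √(R ^ 2 - t ^ 2) = B at *
  rcases eq_or_lt_of_le (show 0 ≤ R by linarith) with rfl | hR
  · have : s = 0 := by linarith
    have : t = 0 := by linarith
    subst s t
    have : A = B := by nlinarith
    simp [this]
  · have h5 : |A - B| * (A + B) = |s - t| * (s + t) := by
      rw [← abs_of_nonneg (show 0 ≤ A + B by linarith),
        ← abs_of_nonneg (show 0 ≤ s + t by linarith), ← abs_mul, ← abs_mul, ← abs_neg]
      congr 1
      nlinarith
    have h6 : |s - t| * (s + t) ≤ |s - t| * (A + B) :=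
      mul_le_mul_of_nonneg_left (by linarith) (abs_nonneg _)
    exact le_of_mul_le_mul_right (h5.trans_le h6) (by linarith)

theorem isSmoothSet_ball {R : ℝ} (hR : 0 < R) :
    IsSmoothSet (Metric.ball (0 : EuclideanSpace ℝ (Fin n)) R) := by
  refine ⟨Metric.isBounded_ball, Metric.isOpen_ball, R / 2, half_pos hR, fun x₀ hx₀ => ?_⟩
  rw [frontier_ball _ hR.ne', mem_sphere_zero_iff_norm] at hx₀
  -- Truncating at `R / 2` makes the spherical cap function globally 1-Lipschitz. In the ball of
  -- radius `R / 2` about `x₀` the projection has norm below `R / 2`, so the truncation is inactive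
  -- there.
  refine ⟨R⁻¹ • x₀, fun y => √(R ^ 2 - (min ‖y‖ (R / 2)) ^ 2), 1, ?_, ?_, ?_⟩
  · rw [norm_smul, hx₀, norm_inv, Real.norm_of_nonneg hR.le, inv_mul_cancel₀ hR.ne']
  · apply LipschitzWith.of_dist_le_mul
    intro y z
    have h0 : ∀ w : EuclideanSpace ℝ (Fin n), 0 ≤ min ‖w‖ (R / 2) := fun w =>
      le_min (norm_nonneg _) (half_pos hR).le
    refine (abs_sqrt_sub_sqrt_le (h0 y) (min_le_right _ _) (h0 z) (min_le_right _ _)).trans ?_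
    have := (lipschitzWith_one_norm (E := EuclideanSpace ℝ (Fin n))).min_const (R / 2)
    exact this.dist_le_mul y z
  · intro x hx
    set e := R⁻¹ • x₀ with he
    have hne : ‖e‖ = 1 := by
      rw [he, norm_smul, hx₀, norm_inv, Real.norm_of_nonneg hR.le, inv_mul_cancel₀ hR.ne']
    have hproj : ∀ u : EuclideanSpace ℝ (Fin n),
        ‖u - (inner ℝ e u : ℝ) • e‖ ^ 2 = ‖u‖ ^ 2 - (inner ℝ e u : ℝ) ^ 2 := by
      intro u
      rw [norm_sub_sq_real, inner_smul_right, real_inner_comm, norm_smul, hne, mul_one,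
        Real.norm_eq_abs, sq_abs]
      ring
    have hx₀e : x₀ = R • e := by rw [he, smul_inv_smul₀ hR.ne']
    have hd : ‖x - x₀‖ < R / 2 := by rwa [Metric.mem_ball, dist_eq_norm] at hx
    have hinner : inner ℝ e x = R + inner ℝ e (x - x₀) := by
      rw [inner_sub_right, hx₀e, inner_smul_right, real_inner_self_eq_norm_sq, hne]; ring
    have hpr : x - (inner ℝ e x : ℝ) • e = (x - x₀) - (inner ℝ e (x - x₀) : ℝ) • e := by
      rw [hinner, add_smul, ← hx₀e]; abel
    have hsmall : ‖x - (inner ℝ e x : ℝ) • e‖ < R / 2 := by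
      apply lt_of_pow_lt_pow_left₀ 2 (half_pos hR).le
      rw [hpr, hproj]
      have := mul_self_lt_mul_self (norm_nonneg _) hd
      nlinarith [sq_nonneg (inner ℝ e (x - x₀) : ℝ)]
    have hpos : 0 < (inner ℝ e x : ℝ) := by
      have := abs_real_inner_le_norm e (x - x₀)
      rw [hne, one_mul, abs_le] at this
      linarith [this.1]
    beta_reduce
    rw [min_eq_left hsmall.le, hproj]
    have hnorm : R ^ 2 - (‖x‖ ^ 2 - (inner ℝ e x : ℝ) ^ 2)
        = (inner ℝ e x : ℝ) ^ 2 + (R ^ 2 - ‖x‖ ^ 2) := by ring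
    rw [hnorm, frontier_ball _ hR.ne', mem_sphere_zero_iff_norm, mem_ball_zero_iff]
    constructor
    · rw [eq_comm (a := (inner ℝ e x : ℝ)), Real.sqrt_eq_iff_mul_self_eq_of_pos hpos,
        ← sq_eq_sq₀ (norm_nonneg x) hR.le]
      constructor <;> intro h <;> linarith
    · rw [Real.lt_sqrt hpos.le, ← pow_lt_pow_iff_left₀ (norm_nonneg x) hR.le two_ne_zero]
      constructor <;> intro h <;> linarith

theorem tendsto_lintegral_pow_Ico_div (k : ℕ) :
    Tendsto (fun r : ℝ => (∫⁻ s in Set.Ico (1 : ℝ) (1 + r), ENNReal.ofReal (s ^ k)) /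
      ENNReal.ofReal r) (𝓝[>] 0) (𝓝 1) := by
  have hlim : Tendsto (fun r : ℝ => ENNReal.ofReal ((1 + r) ^ k)) (𝓝[>] 0) (𝓝 1) := by
    have : Continuous fun r : ℝ => ENNReal.ofReal ((1 + r) ^ k) :=
      ENNReal.continuous_ofReal.comp (by fun_prop)
    simpa using (this.tendsto 0).mono_left nhdsWithin_le_nhds
  refine tendsto_of_tendsto_of_tendsto_of_le_of_le' tendsto_const_nhds hlim ?_ ?_
  · filter_upwards [self_mem_nhdsWithin] with r (hr : 0 < r)
    rw [ENNReal.le_div_iff_mul_le (Or.inl (by simpa using hr)) (Or.inl ENNReal.ofReal_ne_top)]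
    calc 1 * ENNReal.ofReal r = ∫⁻ _ in Set.Ico (1 : ℝ) (1 + r), 1 := by simp
      _ ≤ _ := setLIntegral_mono' measurableSet_Ico fun s hs => by
          rw [ENNReal.one_le_ofReal]
          exact one_le_pow₀ hs.1
  · filter_upwards [self_mem_nhdsWithin] with r (hr : 0 < r)
    apply ENNReal.div_le_of_le_mul
    calc _ ≤ ∫⁻ _ in Set.Ico (1 : ℝ) (1 + r), ENNReal.ofReal ((1 + r) ^ k) :=
          setLIntegral_mono' measurableSet_Ico fun s hs => by
            apply ENNReal.ofReal_le_ofReal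
            have : 0 ≤ s := zero_le_one.trans hs.1
            gcongr
            exact hs.2.le
      _ = _ := by simp

/-- Both sides are the limit of the same collar quotients of the unit ball: one by the Minkowski
content theorem, the other by polar coordinates. -/
theorem lintegral_sphere_eq_lintegral_toSphere [NeZero n]
    {ψ : EuclideanSpace ℝ (Fin n) → ℝ} (hψ : Continuous ψ) (hψ0 : ∀ x, 0 ≤ ψ x) :
    ∫⁻ x in Metric.sphere (0 : EuclideanSpace ℝ (Fin n)) 1, ENNReal.ofReal (ψ x)
        ∂(Measure.euclideanHausdorffMeasure (n - 1)) =
      ∫⁻ θ, ENNReal.ofReal (ψ θ)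
        ∂(volume : Measure (EuclideanSpace ℝ (Fin n))).toSphere := by
  -- Outside the unit ball this is `ψ (x / ‖x‖)`; the maximum keeps it continuous at the origin.
  set φ : EuclideanSpace ℝ (Fin n) → ℝ := fun x => ψ ((max 1 ‖x‖)⁻¹ • x) with hφdef
  have hφ : Continuous φ := by
    have : ∀ x : EuclideanSpace ℝ (Fin n), max 1 ‖x‖ ≠ 0 := fun x =>
      (zero_lt_one.trans_le (le_max_left _ _)).ne'
    exact hψ.comp (((continuous_const.max continuous_norm).inv₀ this).smul continuous_id)
  have hφm : Measurable fun x => ENNReal.ofReal (φ x) := hφ.measurable.ennreal_ofReal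
  have h1 := (isSmoothSet_ball (n := n) one_pos).tendsto_lintegral_collar hφ fun x => hψ0 _
  rw [frontier_ball _ one_ne_zero] at h1
  have h2 : ∫⁻ x in Metric.sphere (0 : EuclideanSpace ℝ (Fin n)) 1, ENNReal.ofReal (φ x)
      ∂(Measure.euclideanHausdorffMeasure (n - 1)) =
      ∫⁻ x in Metric.sphere (0 : EuclideanSpace ℝ (Fin n)) 1, ENNReal.ofReal (ψ x)
      ∂(Measure.euclideanHausdorffMeasure (n - 1)) := by
    refine setLIntegral_congr_fun Metric.isClosed_sphere.measurableSet fun x hx => ?_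
    rw [mem_sphere_zero_iff_norm] at hx
    simp [hφdef, hx]
  rw [h2] at h1
  refine tendsto_nhds_unique h1 ?_
  have h3 := ENNReal.Tendsto.const_mul (a := ∫⁻ θ, ENNReal.ofReal (ψ θ)
    ∂(volume : Measure (EuclideanSpace ℝ (Fin n))).toSphere)
    (tendsto_lintegral_pow_Ico_div (n - 1)) (Or.inl one_ne_zero)
  rw [mul_one] at h3
  refine h3.congr' ?_
  filter_upwards [self_mem_nhdsWithin] with r (hr : 0 < r)
  have hA : MeasurableSet (Metric.ball (0 : EuclideanSpace ℝ (Fin n)) (r + 1) \ Metric.ball 0 1) :=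
    measurableSet_ball.diff measurableSet_ball
  rw [thickening_ball hr one_pos, ← mul_div_assoc]
  congr 1
  rw [← lintegral_indicator hA, lintegral_eq_lintegral_toSphere _ (hφm.indicator hA),
    finrank_euclideanSpace_fin, ← lintegral_mul_const _ (by fun_prop)]
  refine lintegral_congr fun θ => ?_
  rw [← lintegral_indicator measurableSet_Ioi, ← lintegral_indicator measurableSet_Ico,
    ← lintegral_const_mul _ (by
      apply Measurable.indicator _ measurableSet_Ico
      fun_prop)]
  refine lintegral_congr fun s => ?_
  have hθ : ‖(θ : EuclideanSpace ℝ (Fin n))‖ = 1 := by simp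
  by_cases hs : s ∈ Set.Ico 1 (1 + r)
  · have hs0 : 0 < s := zero_lt_one.trans_le hs.1
    have hns : ‖s • (θ : EuclideanSpace ℝ (Fin n))‖ = s := by
      rw [norm_smul, hθ, Real.norm_of_nonneg hs0.le, mul_one]
    have hmem : s • (θ : EuclideanSpace ℝ (Fin n)) ∈ Metric.ball 0 (r + 1) \ Metric.ball 0 1 := by
      rw [Set.mem_sdiff, mem_ball_zero_iff, mem_ball_zero_iff, hns]
      exact ⟨by linarith [hs.2], by linarith [hs.1]⟩
    rw [Set.indicator_of_mem hs, Set.indicator_of_mem (Set.mem_Ioi.2 hs0),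
      Set.indicator_of_mem hmem, hφdef]
    simp only
    rw [hns, max_eq_right hs.1, inv_smul_smul₀ hs0.ne', mul_comm]
  · rw [Set.indicator_of_notMem hs, mul_zero]
    by_cases hs0 : 0 < s
    · have hns : ‖s • (θ : EuclideanSpace ℝ (Fin n))‖ = s := by
        rw [norm_smul, hθ, Real.norm_of_nonneg hs0.le, mul_one]
      have hmem : s • (θ : EuclideanSpace ℝ (Fin n)) ∉
          Metric.ball 0 (r + 1) \ Metric.ball 0 1 := by
        rw [Set.mem_sdiff, mem_ball_zero_iff, mem_ball_zero_iff, hns]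
        rintro ⟨h4, h5⟩
        exact hs ⟨not_lt.1 h5, by linarith⟩
      rw [Set.indicator_of_mem (Set.mem_Ioi.2 hs0), Set.indicator_of_notMem hmem, mul_zero]
    · rw [Set.indicator_of_notMem (by simpa using hs0)]

/-- The surface measure of the unit sphere is its Hausdorff measure. -/
theorem map_toSphere_eq_restrict_euclideanHausdorffMeasure [NeZero n] :
    (volume : Measure (EuclideanSpace ℝ (Fin n))).toSphere.map (↑) =
      (Measure.euclideanHausdorffMeasure (n - 1)).restrict
        (Metric.sphere (0 : EuclideanSpace ℝ (Fin n)) 1) := by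
  apply ext_of_forall_lintegral_eq_of_IsFiniteMeasure
  intro f
  have hf : Continuous fun x => (f x : ℝ) := NNReal.continuous_coe.comp f.continuous
  have := lintegral_sphere_eq_lintegral_toSphere hf fun x => (f x).2
  simp only [ENNReal.ofReal_coe_nnreal] at this
  rw [this, lintegral_map (by fun_prop) measurable_subtype_coe]

theorem toSphere_apply_eq_euclideanHausdorffMeasure [NeZero n]
    (A : Set (Metric.sphere (0 : EuclideanSpace ℝ (Fin n)) 1)) :
    (volume : Measure (EuclideanSpace ℝ (Fin n))).toSphere A =
      Measure.euclideanHausdorffMeasure (n - 1) ((↑) '' A : Set (EuclideanSpace ℝ (Fin n))) := by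
  have hemb : MeasurableEmbedding
      ((↑) : Metric.sphere (0 : EuclideanSpace ℝ (Fin n)) 1 → EuclideanSpace ℝ (Fin n)) :=
    MeasurableEmbedding.subtype_coe Metric.isClosed_sphere.measurableSet
  have h := congrArg (fun ν => ν ((↑) '' A : Set (EuclideanSpace ℝ (Fin n))))
    (map_toSphere_eq_restrict_euclideanHausdorffMeasure (n := n))
  simp only [hemb.map_apply, Set.preimage_image_eq _ Subtype.val_injective] at h
  rw [h, Measure.restrict_eq_self]
  rintro _ ⟨x, -, rfl⟩
  exact x.2

end Spheres

/-! ### Convexity of `exp a` in the variable `∫ exp a` -/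

section Convexity

/-- Formally `(exp b)' ≥ c exp b`, integrated over `[0, L]`. As `b` need not be differentiable,
right difference quotients are used, bounded through `1 + s ≤ exp s`; the signs are reversed because
the comparison principle gives upper bounds. -/
theorem exp_add_mul_integral_exp_le {b : ℝ → ℝ} (hb : Continuous b) {L c : ℝ} (hL : 0 ≤ L)
    (hc : ∀ u v, 0 ≤ u → u < v → v ≤ L → b u + c * (v - u) ≤ b v) :
    Real.exp (b 0) + c * ∫ s in (0 : ℝ)..L, Real.exp (b s) ≤ Real.exp (b L) := by
  have hE : Continuous fun s => Real.exp (b s) := by fun_prop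
  have hint : ∀ x y, IntervalIntegrable (fun s => Real.exp (b s)) volume x y :=
    fun x y => hE.intervalIntegrable x y
  have hderiv : ∀ x, HasDerivAt (fun x => -(Real.exp (b 0) + c * ∫ s in (0 : ℝ)..x, Real.exp (b s)))
      (-(c * Real.exp (b x))) x := by
    intro x
    exact (((intervalIntegral.integral_hasDerivAt_right (hint 0 x)
      (hE.stronglyMeasurableAtFilter _ _) hE.continuousAt).const_mul c).const_add _).neg
  have key := image_le_of_liminf_slope_right_le_deriv_boundary (a := 0) (b := L)
    (f := fun s => -Real.exp (b s)) (B' := fun x => -(c * Real.exp (b x)))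
    (B := fun x => -(Real.exp (b 0) + c * ∫ s in (0 : ℝ)..x, Real.exp (b s)))
    hE.neg.continuousOn (by simp)
    (fun x _ => (hderiv x).continuousAt.continuousWithinAt)
    (fun x _ => (hderiv x).hasDerivWithinAt) (by
      intro x hx r hr
      refine Eventually.frequently ?_
      filter_upwards [Ioo_mem_nhdsGT hx.2] with z ⟨hz, hzL⟩
      refine lt_of_le_of_lt ?_ hr
      rw [slope_def_field, div_le_iff₀ (sub_pos.2 hz)]
      have h1 := hc x z hx.1 hz hzL.le
      have h2 : Real.exp (b x) * (b z - b x + 1) ≤ Real.exp (b z) := by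
        have : Real.exp (b z) = Real.exp (b x) * Real.exp (b z - b x) := by
          rw [← Real.exp_add]; ring_nf
        rw [this]
        gcongr
        exact Real.add_one_le_exp _
      nlinarith [Real.exp_pos (b x)])
  have := key (x := L) ⟨hL, le_rfl⟩
  linarith

/-- The supremum of the chord slopes ending at `R` from the left works, since each of them is at
most every chord slope to the right. -/
theorem ConvexOn.exists_supporting_slope {a : ℝ → ℝ} (ha : ConvexOn ℝ (Set.Ici 0) a) {R : ℝ}
    (hR : 0 < R) : ∃ c, (∀ v, R < v → c ≤ (a v - a R) / (v - R)) ∧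
      ∀ u, 0 ≤ u → u < R → (a R - a u) / (R - u) ≤ c := by
  have hle : ∀ u v, 0 ≤ u → u < R → R < v → (a R - a u) / (R - u) ≤ (a v - a R) / (v - R) :=
    fun u v hu huR hRv => ha.slope_mono_adjacent hu (hR.le.trans hRv.le) huR hRv
  have hbdd : BddAbove ((fun u => (a R - a u) / (R - u)) '' Set.Ico 0 R) := by
    refine ⟨(a (R + 1) - a R) / (R + 1 - R), ?_⟩
    rintro _ ⟨u, ⟨hu, huR⟩, rfl⟩
    exact hle u (R + 1) hu huR (by linarith)
  refine ⟨sSup ((fun u => (a R - a u) / (R - u)) '' Set.Ico 0 R), fun v hv => ?_,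
    fun u hu huR => le_csSup hbdd ⟨u, ⟨hu, huR⟩, rfl⟩⟩
  refine csSup_le ⟨_, 0, ⟨le_rfl, hR⟩, rfl⟩ ?_
  rintro _ ⟨u, ⟨hu, huR⟩, rfl⟩
  exact hle u v hu huR hv

/-- Along the variable `∫₀ˢ exp a`, the function `exp a` lies above a supporting line. -/
theorem ConvexOn.exists_exp_supporting_line {a : ℝ → ℝ} (ha : ConvexOn ℝ (Set.Ici 0) a)
    (hac : Continuous a) {R : ℝ} (hR : 0 < R) :
    ∃ c, ∀ s, 0 ≤ s → Real.exp (a R) + c * ((∫ u in (0 : ℝ)..s, Real.exp (a u)) -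
      ∫ u in (0 : ℝ)..R, Real.exp (a u)) ≤ Real.exp (a s) := by
  obtain ⟨c, hc1, hc2⟩ := ha.exists_supporting_slope hR
  have hE : Continuous fun s => Real.exp (a s) := by fun_prop
  have hsub : ∀ s, (∫ u in (0 : ℝ)..s, Real.exp (a u)) - ∫ u in (0 : ℝ)..R, Real.exp (a u) =
      ∫ u in R..s, Real.exp (a u) := fun s =>
    intervalIntegral.integral_interval_sub_left (hE.intervalIntegrable _ _)
      (hE.intervalIntegrable _ _)
  refine ⟨c, fun s hs => ?_⟩
  rw [hsub]
  rcases le_total R s with h | h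
  · have := exp_add_mul_integral_exp_le (b := fun u => a (R + u)) (L := s - R) (c := c)
      (by fun_prop) (by linarith) (by
        intro u v hu huv hv
        have h1 : c ≤ (a (R + v) - a (R + u)) / ((R + v) - (R + u)) := by
          rcases eq_or_lt_of_le hu with rfl | hu
          · simpa using hc1 (R + v) (by linarith)
          · refine (hc1 (R + u) (by linarith)).trans ?_
            exact ha.slope_mono_adjacent hR.le (by simp only [Set.mem_Ici]; linarith)
              (by linarith) (by linarith)
        rw [le_div_iff₀ (by linarith)] at h1
        linarith)
    rw [intervalIntegral.integral_comp_add_left (fun u => Real.exp (a u))] at this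
    simpa using this
  -- To the left of `R`, reflection turns chord slopes at most `c` into chord slopes at least `-c`.
  · have := exp_add_mul_integral_exp_le (b := fun u => a (R - u)) (L := R - s) (c := -c)
      (by fun_prop) (by linarith) (by
        intro u v hu huv hv
        have h1 : (a (R - u) - a (R - v)) / ((R - u) - (R - v)) ≤ c := by
          rcases eq_or_lt_of_le hu with rfl | hu
          · simpa using hc2 (R - v) (by linarith) (by linarith)
          · refine le_trans ?_ (hc2 (R - u) (by linarith) (by linarith))
            exact ha.slope_mono_adjacent (by simp only [Set.mem_Ici]; linarith) hR.le
              (by linarith) (by linarith)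
        rw [div_le_iff₀ (by linarith)] at h1
        linarith)
    rw [intervalIntegral.integral_comp_sub_left (fun u => Real.exp (a u))] at this
    rw [intervalIntegral.integral_symm]
    simp only [sub_sub_cancel, sub_zero] at this
    linarith

end Convexity

/-! ### Radial projection onto the unit sphere -/

section RadialProjection

open scoped ENNReal NNReal

/-- Squared, the left side is `(2‖x‖‖y‖ - 2⟪x, y⟫) / (‖x‖‖y‖)`, whose numerator is at most `‖x -
y‖²` and whose denominator is at least `ρ²`. -/
theorem dist_normalize_le {E : Type*} [NormedAddCommGroup E] [InnerProductSpace ℝ E] {ρ : ℝ}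
    (hρ : 0 < ρ) {x y : E} (hx : ρ ≤ ‖x‖) (hy : ρ ≤ ‖y‖) :
    dist (‖x‖⁻¹ • x) (‖y‖⁻¹ • y) ≤ ρ⁻¹ * dist x y := by
  have hx0 : 0 < ‖x‖ := hρ.trans_le hx
  have hy0 : 0 < ‖y‖ := hρ.trans_le hy
  rw [← pow_le_pow_iff_left₀ dist_nonneg (by positivity) two_ne_zero, mul_pow, dist_eq_norm,
    dist_eq_norm, norm_sub_sq_real, norm_sub_sq_real, norm_smul, norm_smul, real_inner_smul_left,
    real_inner_smul_right, norm_inv, norm_norm, norm_inv, norm_norm, inv_mul_cancel₀ hx0.ne',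
    inv_mul_cancel₀ hy0.ne']
  have h1 : (2 : ℝ) - 2 * (‖x‖⁻¹ * (‖y‖⁻¹ * inner ℝ x y)) =
      (2 * (‖x‖ * ‖y‖) - 2 * inner ℝ x y) / (‖x‖ * ‖y‖) := by
    field_simp
  have h2 : 0 ≤ 2 * (‖x‖ * ‖y‖) - 2 * (inner ℝ x y : ℝ) := by
    have := real_inner_le_norm x y; linarith
  calc (1 : ℝ) ^ 2 - 2 * (‖x‖⁻¹ * (‖y‖⁻¹ * inner ℝ x y)) + 1 ^ 2
      = (2 * (‖x‖ * ‖y‖) - 2 * inner ℝ x y) / (‖x‖ * ‖y‖) := by rw [← h1]; ring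
    _ ≤ (2 * (‖x‖ * ‖y‖) - 2 * inner ℝ x y) / (ρ * ρ) := by gcongr
    _ ≤ (‖x‖ ^ 2 - 2 * inner ℝ x y + ‖y‖ ^ 2) / (ρ * ρ) := by
        gcongr
        nlinarith [sq_nonneg (‖x‖ - ‖y‖)]
    _ = _ := by field_simp

variable {n : ℕ}

/-- The directions of the points of a set. -/
def radialShadow (A : Set (EuclideanSpace ℝ (Fin n))) :
    Set (Metric.sphere (0 : EuclideanSpace ℝ (Fin n)) 1) :=
  {θ | ∃ r : ℝ, 0 < r ∧ r • (θ : EuclideanSpace ℝ (Fin n)) ∈ A}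

theorem toSphere_radialShadow_le_of_le_norm [NeZero n] {A : Set (EuclideanSpace ℝ (Fin n))}
    {ρ : ℝ} (hρ : 0 < ρ) (hA : ∀ x ∈ A, ρ ≤ ‖x‖) :
    (volume : Measure (EuclideanSpace ℝ (Fin n))).toSphere (radialShadow A) ≤
      ENNReal.ofReal (ρ⁻¹) ^ (n - 1) * Measure.euclideanHausdorffMeasure (n - 1) A := by
  rw [toSphere_apply_eq_euclideanHausdorffMeasure]
  have himg : ((↑) '' (radialShadow A) : Set (EuclideanSpace ℝ (Fin n))) ⊆
      (fun x => ‖x‖⁻¹ • x) '' A := by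
    rintro _ ⟨θ, ⟨r, hr, hrA⟩, rfl⟩
    refine ⟨_, hrA, ?_⟩
    have hθ : ‖(θ : EuclideanSpace ℝ (Fin n))‖ = 1 := by simp
    simp only
    rw [norm_smul, hθ, Real.norm_of_nonneg hr.le, mul_one, inv_smul_smul₀ hr.ne']
  refine (measure_mono himg).trans ?_
  have := euclideanHausdorffMeasure_image_le_of_edist_le (n - 1) (Real.toNNReal ρ⁻¹)
    (f := fun x : EuclideanSpace ℝ (Fin n) => ‖x‖⁻¹ • x) (g := id) (S := A) (by
      intro x hx y hy
      rw [edist_dist, edist_dist]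
      change _ ≤ ENNReal.ofReal ρ⁻¹ * _
      rw [← ENNReal.ofReal_mul (by positivity)]
      exact ENNReal.ofReal_le_ofReal (dist_normalize_le hρ (hA x hx) (hA y hy)))
  rwa [Set.image_id] at this

/-- Cut `A` into shells `κ ^ k ≤ ‖x‖ < κ ^ (k + 1)`, where the Lipschitz constant `κ ^ (-k)` of the
projection is at most `κ / ‖x‖`, and let `κ → 1`. Countable subadditivity suffices, so shadows need
not be measurable. -/
theorem toSphere_radialShadow_le [NeZero n] {A : Set (EuclideanSpace ℝ (Fin n))}
    (hA : MeasurableSet A) :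
    (volume : Measure (EuclideanSpace ℝ (Fin n))).toSphere (radialShadow A) ≤
      ∫⁻ x in A, ENNReal.ofReal ‖x‖⁻¹ ^ (n - 1)
        ∂(Measure.euclideanHausdorffMeasure (n - 1)) := by
  set H : Measure (EuclideanSpace ℝ (Fin n)) := Measure.euclideanHausdorffMeasure (n - 1)
  have hw : Measurable fun x : EuclideanSpace ℝ (Fin n) => ENNReal.ofReal ‖x‖⁻¹ ^ (n - 1) := by
    fun_prop
  have key : ∀ κ : ℝ, 1 < κ →
      (volume : Measure (EuclideanSpace ℝ (Fin n))).toSphere (radialShadow A) ≤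
        ENNReal.ofReal κ ^ (n - 1) * ∫⁻ x in A, ENNReal.ofReal ‖x‖⁻¹ ^ (n - 1) ∂H := by
    intro κ hκ
    have hκ0 : 0 < κ := zero_lt_one.trans hκ
    set S : ℤ → Set (EuclideanSpace ℝ (Fin n)) :=
      fun k => A ∩ (fun x => ‖x‖) ⁻¹' Set.Ico (κ ^ k) (κ ^ (k + 1)) with hS
    have hSm : ∀ k, MeasurableSet (S k) := fun k =>
      hA.inter (measurable_norm measurableSet_Ico)
    have hSd : Pairwise (Function.onFun Disjoint S) := by
      have hmono : Monotone fun k : ℤ => κ ^ k := zpow_right_mono₀ hκ.le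
      have := hmono.pairwise_disjoint_on_Ico_succ
      intro i j hij
      exact ((this hij).preimage _).mono Set.inter_subset_right Set.inter_subset_right
    have hcov : radialShadow A ⊆ ⋃ k, radialShadow (S k) := by
      rintro θ ⟨r, hr, hrA⟩
      have hθ : ‖(θ : EuclideanSpace ℝ (Fin n))‖ = 1 := by simp
      obtain ⟨k, hk⟩ := exists_mem_Ico_zpow hr hκ
      refine Set.mem_iUnion.2 ⟨k, r, hr, hrA, ?_⟩
      rw [Set.mem_preimage, norm_smul, hθ, Real.norm_of_nonneg hr.le, mul_one]
      exact hk
    calc _ ≤ ∑' k, (volume : Measure (EuclideanSpace ℝ (Fin n))).toSphere (radialShadow (S k)) :=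
          (measure_mono hcov).trans (measure_iUnion_le _)
      _ ≤ ∑' k, ENNReal.ofReal κ ^ (n - 1) * ∫⁻ x in S k, ENNReal.ofReal ‖x‖⁻¹ ^ (n - 1) ∂H := by
          refine ENNReal.tsum_le_tsum fun k => ?_
          have hk0 : 0 < κ ^ k := zpow_pos hκ0 k
          refine (toSphere_radialShadow_le_of_le_norm hk0 fun x hx => hx.2.1).trans ?_
          rw [← lintegral_const_mul _ hw, ← setLIntegral_const]
          refine setLIntegral_mono' (hSm k) fun x hx => ?_
          rw [← mul_pow, ← ENNReal.ofReal_mul hκ0.le]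
          gcongr
          have hx1 : κ ^ k ≤ ‖x‖ := hx.2.1
          have hx2 : ‖x‖ < κ ^ (k + 1) := hx.2.2
          rw [zpow_add_one₀ hκ0.ne'] at hx2
          have hx0 : 0 < ‖x‖ := hk0.trans_le hx1
          rw [inv_eq_one_div, ← div_eq_mul_inv, div_le_div_iff₀ hk0 hx0]
          linarith
      _ = ENNReal.ofReal κ ^ (n - 1) * ∑' k, ∫⁻ x in S k, ENNReal.ofReal ‖x‖⁻¹ ^ (n - 1) ∂H :=
          ENNReal.tsum_mul_left
      _ = ENNReal.ofReal κ ^ (n - 1) *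
          ∫⁻ x in ⋃ k, S k, ENNReal.ofReal ‖x‖⁻¹ ^ (n - 1) ∂H := by
          rw [lintegral_iUnion hSm hSd]
      _ ≤ _ := by
          gcongr
          exact Set.iUnion_subset fun k => Set.inter_subset_left
  have hlim : Tendsto (fun κ : ℝ => ENNReal.ofReal κ ^ (n - 1)) (𝓝[>] 1) (𝓝 1) := by
    have : Continuous fun κ : ℝ => ENNReal.ofReal κ ^ (n - 1) :=
      (ENNReal.continuous_pow _).comp ENNReal.continuous_ofReal
    simpa using (this.tendsto 1).mono_left nhdsWithin_le_nhds
  have hlim' := ENNReal.Tendsto.mul_const (b := ∫⁻ x in A, ENNReal.ofReal ‖x‖⁻¹ ^ (n - 1) ∂H)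
    hlim (Or.inl one_ne_zero)
  rw [one_mul] at hlim'
  refine ge_of_tendsto hlim' ?_
  filter_upwards [self_mem_nhdsWithin] with κ hκ using key κ hκ

/-- Layer cake: directions with `f > t` lie in the shadow of the part of `A` where `G > t`, so the
shadow bound applies level by level and the radii need not depend measurably on θ. -/
theorem lintegral_toSphere_le_of_exists_mem [NeZero n] {A : Set (EuclideanSpace ℝ (Fin n))}
    (hA : MeasurableSet A) {G : EuclideanSpace ℝ (Fin n) → ℝ} (hG : Measurable G)
    (hG0 : ∀ x, 0 ≤ G x) {f : Metric.sphere (0 : EuclideanSpace ℝ (Fin n)) 1 → ℝ}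
    (hf : Measurable f) (hf0 : ∀ θ, 0 ≤ f θ)
    (h : ∀ θ : Metric.sphere (0 : EuclideanSpace ℝ (Fin n)) 1, ∃ r : ℝ, 0 < r ∧ r • (θ : EuclideanSpace ℝ (Fin n)) ∈ A ∧
      f θ ≤ G (r • (θ : EuclideanSpace ℝ (Fin n)))) :
    ∫⁻ θ, ENNReal.ofReal (f θ) ∂(volume : Measure (EuclideanSpace ℝ (Fin n))).toSphere ≤
      ∫⁻ x in A, ENNReal.ofReal ‖x‖⁻¹ ^ (n - 1) * ENNReal.ofReal (G x)
        ∂(Measure.euclideanHausdorffMeasure (n - 1)) := by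
  set H : Measure (EuclideanSpace ℝ (Fin n)) := Measure.euclideanHausdorffMeasure (n - 1)
  have hw : Measurable fun x : EuclideanSpace ℝ (Fin n) => ENNReal.ofReal ‖x‖⁻¹ ^ (n - 1) := by
    fun_prop
  set ν := (H.restrict A).withDensity fun x => ENNReal.ofReal ‖x‖⁻¹ ^ (n - 1)
  have hν : ∫⁻ x in A, ENNReal.ofReal ‖x‖⁻¹ ^ (n - 1) * ENNReal.ofReal (G x) ∂H =
      ∫⁻ x, ENNReal.ofReal (G x) ∂ν :=
    (lintegral_withDensity_eq_lintegral_mul _ hw hG.ennreal_ofReal).symm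
  rw [hν, lintegral_eq_lintegral_meas_lt _ (Eventually.of_forall hf0) hf.aemeasurable,
    lintegral_eq_lintegral_meas_lt _ (Eventually.of_forall hG0) hG.aemeasurable]
  refine lintegral_mono fun t => ?_
  have hGt : MeasurableSet {x | t < G x} := measurableSet_lt measurable_const hG
  have hsub : {θ : Metric.sphere (0 : EuclideanSpace ℝ (Fin n)) 1 | t < f θ} ⊆ radialShadow (A ∩ {x | t < G x}) := by
    intro θ hθ
    obtain ⟨r, hr, hrA, hfG⟩ := h θ
    exact ⟨r, hr, hrA, hθ.trans_le hfG⟩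
  refine (measure_mono hsub).trans ((toSphere_radialShadow_le (hA.inter hGt)).trans ?_)
  rw [withDensity_apply _ hGt, Measure.restrict_restrict hGt, Set.inter_comm]

end RadialProjection

/-! ### The radial measure and the isoperimetric inequality -/

section RadialMeasure

open scoped ENNReal NNReal

variable {n : ℕ} {a : ℝ → ℝ}

theorem radialDensity_eq [NeZero n] (a : ℝ → ℝ) (x : EuclideanSpace ℝ (Fin n)) :
    radialDensity n a x = ENNReal.ofReal ‖x‖⁻¹ ^ (n - 1) * ENNReal.ofReal (Real.exp (a ‖x‖)) := by
  have h : (1 - (n : ℤ)) = -((n - 1 : ℕ) : ℤ) := by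
    have := NeZero.one_le (n := n)
    push_cast [this]
    ring
  rw [radialDensity, h, zpow_neg, zpow_natCast, ← inv_pow, ENNReal.ofReal_mul (by positivity),
    ENNReal.ofReal_pow (by positivity)]

theorem measurable_radialDensity [NeZero n] (ha : Continuous a) :
    Measurable (radialDensity n a) := by
  have : radialDensity n a = fun x => ENNReal.ofReal ‖x‖⁻¹ ^ (n - 1) *
      ENNReal.ofReal (Real.exp (a ‖x‖)) := funext (radialDensity_eq a)
  rw [this]
  have := ha.measurable
  fun_prop

/-- The radii at which the ray in direction `θ` meets `X`. -/
def raySlice (X : Set (EuclideanSpace ℝ (Fin n)))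
    (θ : Metric.sphere (0 : EuclideanSpace ℝ (Fin n)) 1) : Set ℝ :=
  {r | 0 < r ∧ r • (θ : EuclideanSpace ℝ (Fin n)) ∈ X}

/-- The mass of `X` along the ray in direction `θ`. -/
noncomputable def rayMass (a : ℝ → ℝ) (X : Set (EuclideanSpace ℝ (Fin n)))
    (θ : Metric.sphere (0 : EuclideanSpace ℝ (Fin n)) 1) : ℝ≥0∞ :=
  ∫⁻ r in raySlice X θ, ENNReal.ofReal (Real.exp (a r))

theorem norm_smul_sphere (θ : Metric.sphere (0 : EuclideanSpace ℝ (Fin n)) 1) {r : ℝ}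
    (hr : 0 ≤ r) : ‖r • (θ : EuclideanSpace ℝ (Fin n))‖ = r := by
  have hθ : ‖(θ : EuclideanSpace ℝ (Fin n))‖ = 1 := by simp
  rw [norm_smul, hθ, Real.norm_of_nonneg hr, mul_one]

theorem measurableSet_raySlice {X : Set (EuclideanSpace ℝ (Fin n))} (hX : MeasurableSet X)
    (θ : Metric.sphere (0 : EuclideanSpace ℝ (Fin n)) 1) : MeasurableSet (raySlice X θ) := by
  have h : Measurable fun r : ℝ => r • (θ : EuclideanSpace ℝ (Fin n)) := by fun_prop
  exact measurableSet_Ioi.inter (h hX)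

theorem rayMass_eq (a : ℝ → ℝ) {X : Set (EuclideanSpace ℝ (Fin n))} (hX : MeasurableSet X)
    (θ : Metric.sphere (0 : EuclideanSpace ℝ (Fin n)) 1) :
    rayMass a X θ = ∫⁻ r in Set.Ioi (0 : ℝ),
      X.indicator 1 (r • (θ : EuclideanSpace ℝ (Fin n))) * ENNReal.ofReal (Real.exp (a r)) := by
  rw [rayMass, ← lintegral_indicator (measurableSet_raySlice hX θ),
    ← lintegral_indicator measurableSet_Ioi]
  refine lintegral_congr fun r => ?_
  by_cases hr : 0 < r
  · by_cases hm : r • (θ : EuclideanSpace ℝ (Fin n)) ∈ X <;>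
      simp [Set.indicator, raySlice, hr, hm]
  · simp [Set.indicator, raySlice, hr]

theorem measurable_rayMass (ha : Continuous a) {X : Set (EuclideanSpace ℝ (Fin n))}
    (hX : MeasurableSet X) : Measurable (rayMass a X) := by
  have h : Measurable fun q : Metric.sphere (0 : EuclideanSpace ℝ (Fin n)) 1 × ℝ =>
      X.indicator (1 : EuclideanSpace ℝ (Fin n) → ℝ≥0∞)
        (q.2 • (q.1 : EuclideanSpace ℝ (Fin n))) * ENNReal.ofReal (Real.exp (a q.2)) := by
    refine Measurable.mul ((measurable_one.indicator hX).comp ?_) (by fun_prop)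
    exact Continuous.measurable (by fun_prop)
  have := h.lintegral_prod_right' (ν := volume.restrict (Set.Ioi (0 : ℝ)))
  rwa [funext (rayMass_eq a hX)]

/-- The factor `‖x‖ ^ (1 - n)` cancels the polar Jacobian `r ^ (n - 1)`. -/
theorem radialMeasure_apply [NeZero n] (ha : Continuous a) {X : Set (EuclideanSpace ℝ (Fin n))}
    (hX : MeasurableSet X) :
    radialMeasure n a X =
      ∫⁻ θ, rayMass a X θ ∂(volume : Measure (EuclideanSpace ℝ (Fin n))).toSphere := by
  rw [radialMeasure, withDensity_apply _ hX, ← lintegral_indicator hX,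
    lintegral_eq_lintegral_toSphere _ ((measurable_radialDensity ha).indicator hX),
    finrank_euclideanSpace_fin]
  refine lintegral_congr fun θ => ?_
  rw [rayMass_eq a hX]
  refine setLIntegral_congr_fun measurableSet_Ioi fun r (hr : 0 < r) => ?_
  by_cases hm : r • (θ : EuclideanSpace ℝ (Fin n)) ∈ X
  · simp only [Set.indicator_of_mem hm, Pi.one_apply, one_mul]
    rw [radialDensity_eq, norm_smul_sphere θ hr.le, ← mul_assoc,
      ← ENNReal.ofReal_pow (by positivity), ← ENNReal.ofReal_mul (by positivity), ← mul_pow,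
      mul_inv_cancel₀ hr.ne', one_pow, ENNReal.ofReal_one, one_mul]
  · simp [hm]

theorem continuous_integral_exp (ha : Continuous a) :
    Continuous fun s => ∫ u in (0 : ℝ)..s, Real.exp (a u) :=
  intervalIntegral.continuous_primitive
    (fun _ _ => (show Continuous fun u => Real.exp (a u) by fun_prop).intervalIntegrable _ _) 0

theorem strictMono_integral_exp (ha : Continuous a) :
    StrictMono fun s => ∫ u in (0 : ℝ)..s, Real.exp (a u) := by
  have hE : Continuous fun u => Real.exp (a u) := by fun_prop
  intro s t hst
  have h1 := intervalIntegral.integral_interval_sub_left (hE.intervalIntegrable 0 t)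
    (hE.intervalIntegrable 0 s) (μ := volume)
  have h2 := intervalIntegral.intervalIntegral_pos_of_pos (hE.intervalIntegrable s t)
    (fun u => Real.exp_pos _) hst
  simp only
  linarith

theorem lintegral_Ioc_exp (ha : Continuous a) {s : ℝ} (hs : 0 ≤ s) :
    ∫⁻ r in Set.Ioc 0 s, ENNReal.ofReal (Real.exp (a r)) =
      ENNReal.ofReal (∫ u in (0 : ℝ)..s, Real.exp (a u)) := by
  have hE : Continuous fun u => Real.exp (a u) := by fun_prop
  rw [intervalIntegral.integral_of_le hs, ofReal_integral_eq_lintegral_ofReal]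
  · exact (hE.intervalIntegrable 0 s).1
  · exact Eventually.of_forall fun u => (Real.exp_pos _).le

theorem rayMass_le (ha : Continuous a) {X : Set (EuclideanSpace ℝ (Fin n))}
    {θ : Metric.sphere (0 : EuclideanSpace ℝ (Fin n)) 1} {s : ℝ} (hs : 0 ≤ s)
    (h : ∀ r, 0 < r → r • (θ : EuclideanSpace ℝ (Fin n)) ∈ X → r ≤ s) :
    rayMass a X θ ≤ ENNReal.ofReal (∫ u in (0 : ℝ)..s, Real.exp (a u)) := by
  rw [← lintegral_Ioc_exp ha hs]
  exact lintegral_mono_set fun r hr => ⟨hr.1, h r hr.1 hr.2⟩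

theorem le_rayMass (ha : Continuous a) {X : Set (EuclideanSpace ℝ (Fin n))}
    {θ : Metric.sphere (0 : EuclideanSpace ℝ (Fin n)) 1} {s : ℝ} (hs : 0 ≤ s)
    (h : ∀ r, 0 < r → r < s → r • (θ : EuclideanSpace ℝ (Fin n)) ∈ X) :
    ENNReal.ofReal (∫ u in (0 : ℝ)..s, Real.exp (a u)) ≤ rayMass a X θ := by
  rw [← lintegral_Ioc_exp ha hs, ← setLIntegral_congr Ioo_ae_eq_Ioc]
  exact lintegral_mono_set fun r hr => ⟨hr.1, h r hr.1 hr.2⟩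

theorem radialMeasure_ball [NeZero n] (ha : Continuous a) {R : ℝ} (hR : 0 ≤ R) :
    radialMeasure n a (Metric.ball 0 R) =
      (n : ℝ≥0∞) * unitBallVolume n * ENNReal.ofReal (∫ u in (0 : ℝ)..R, Real.exp (a u)) := by
  rw [radialMeasure_apply ha measurableSet_ball]
  have : ∀ θ, rayMass a (Metric.ball (0 : EuclideanSpace ℝ (Fin n)) R) θ =
      ENNReal.ofReal (∫ u in (0 : ℝ)..R, Real.exp (a u)) := by
    intro θ
    refine le_antisymm (rayMass_le ha hR fun r hr h => ?_) (le_rayMass ha hR fun r hr h => ?_)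
    · rw [mem_ball_zero_iff, norm_smul_sphere θ hr.le] at h
      exact h.le
    · rwa [mem_ball_zero_iff, norm_smul_sphere θ hr.le]
  simp_rw [this]
  rw [lintegral_const, Measure.toSphere_apply_univ, finrank_euclideanSpace_fin, mul_comm]
  rfl

theorem sphereMass_ne_zero [NeZero n] : (n : ℝ≥0∞) * unitBallVolume n ≠ 0 := by
  refine mul_ne_zero (by simpa using NeZero.ne n) ?_
  exact (Metric.measure_ball_pos volume _ one_pos).ne'

theorem sphereMass_ne_top : (n : ℝ≥0∞) * unitBallVolume n ≠ ⊤ :=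
  ENNReal.mul_ne_top (ENNReal.natCast_ne_top n) measure_ball_lt_top.ne

theorem existsUnique_radialMeasure_ball_eq [NeZero n] (ha : Continuous a)
    {Ω : Set (EuclideanSpace ℝ (Fin n))} (hb : Bornology.IsBounded Ω)
    (h0 : Ω ∈ 𝓝 (0 : EuclideanSpace ℝ (Fin n))) :
    ∃! R : ℝ, 0 < R ∧ radialMeasure n a (Metric.ball 0 R) = radialMeasure n a Ω := by
  obtain ⟨ρ, hρ, hρΩ⟩ := Metric.mem_nhds_iff.1 h0
  obtain ⟨L, hL, hΩL⟩ := hb.subset_ball_lt 0 0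
  set N : ℝ≥0∞ := (n : ℝ≥0∞) * unitBallVolume n with hN
  have hN0 : N ≠ 0 := sphereMass_ne_zero
  have hNt : N ≠ ⊤ := sphereMass_ne_top
  have hmono := strictMono_integral_exp ha
  set A : ℝ → ℝ := fun s => ∫ u in (0 : ℝ)..s, Real.exp (a u) with hA
  have hA0 : A 0 = 0 := by simp [hA]
  have hpos : ∀ s, 0 < s → 0 < A s := fun s hs => hA0 ▸ hmono hs
  have hball : ∀ R, 0 < R → radialMeasure n a (Metric.ball 0 R) = N * ENNReal.ofReal (A R) :=
    fun R hR => radialMeasure_ball ha hR.le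
  have hlow : N * ENNReal.ofReal (A ρ) ≤ radialMeasure n a Ω := by
    rw [← hball ρ hρ]; exact measure_mono hρΩ
  have hup : radialMeasure n a Ω ≤ N * ENNReal.ofReal (A L) := by
    rw [← hball L hL]; exact measure_mono hΩL
  set V : ℝ≥0∞ := radialMeasure n a Ω / N with hV
  have hVN : N * V = radialMeasure n a Ω := ENNReal.mul_div_cancel hN0 hNt
  have hVlow : ENNReal.ofReal (A ρ) ≤ V := by
    rw [hV, ENNReal.le_div_iff_mul_le (Or.inl hN0) (Or.inl hNt), mul_comm]; exact hlow
  have hVup : V ≤ ENNReal.ofReal (A L) := ENNReal.div_le_of_le_mul (by rwa [mul_comm])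
  have hVt : V ≠ ⊤ := ne_top_of_le_ne_top ENNReal.ofReal_ne_top hVup
  have hVr : V.toReal ∈ Set.Icc (A 0) (A L) := by
    rw [hA0]
    exact ⟨ENNReal.toReal_nonneg, ENNReal.toReal_le_of_le_ofReal (hpos L hL).le hVup⟩
  obtain ⟨R, hR, hRV⟩ := intermediate_value_Icc hL.le (continuous_integral_exp ha).continuousOn hVr
  have hVpos : 0 < V.toReal :=
    (hpos ρ hρ).trans_le ((ENNReal.ofReal_le_iff_le_toReal hVt).1 hVlow)
  have hRpos : 0 < R := by
    refine lt_of_le_of_ne hR.1 fun h => ?_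
    subst h
    change A 0 = V.toReal at hRV
    linarith
  have hRV' : ENNReal.ofReal (A R) = V := by
    change A R = V.toReal at hRV
    rw [hRV, ENNReal.ofReal_toReal hVt]
  refine ⟨R, ⟨hRpos, by rw [hball R hRpos, hRV', hVN]⟩, ?_⟩
  rintro S ⟨hS, hSΩ⟩
  rw [hball S hS, ← hVN, ENNReal.mul_right_inj hN0 hNt, ← hRV',
    ENNReal.ofReal_eq_ofReal_iff (hpos S hS).le (hpos R hRpos).le] at hSΩ
  exact hmono.injective hSΩ

theorem IsSmoothSet.minkowskiContent_eq_weightedPerimeter [NeZero n] (ha : Continuous a)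
    {M : Set (EuclideanSpace ℝ (Fin n))} (hM : IsSmoothSet M)
    (h0 : M ∈ 𝓝 (0 : EuclideanSpace ℝ (Fin n))) (hfin : radialMeasure n a M ≠ ⊤) :
    minkowskiContent (radialMeasure n a) M = weightedPerimeter n a M := by
  obtain ⟨ρ, hρ, hρM⟩ := Metric.mem_nhds_iff.1 h0
  have hopen : IsOpen M := hM.2.1
  have hmax : ∀ x : EuclideanSpace ℝ (Fin n), 0 < max ρ ‖x‖ := fun x =>
    hρ.trans_le (le_max_left _ _)
  -- The maximum with `ρ` removes the singularity at the origin; since `M` contains the ball of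
  -- radius `ρ`, the density is unchanged on collar and frontier.
  set φ : EuclideanSpace ℝ (Fin n) → ℝ :=
    fun x => (max ρ ‖x‖)⁻¹ ^ (n - 1) * Real.exp (a ‖x‖) with hφdef
  have hφ : Continuous φ :=
    (((continuous_const.max continuous_norm).inv₀ fun x => (hmax x).ne').pow _).mul (by fun_prop)
  have hφ0 : ∀ x, 0 ≤ φ x := fun x =>
    mul_nonneg (pow_nonneg (inv_nonneg.2 (hmax x).le) _) (Real.exp_pos _).le
  have heq : ∀ x ∉ M, ENNReal.ofReal (φ x) = radialDensity n a x := by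
    intro x hx
    have hxρ : ρ ≤ ‖x‖ := by
      by_contra h
      exact hx (hρM (mem_ball_zero_iff.2 (not_le.1 h)))
    simp only [hφdef]
    rw [radialDensity_eq, max_eq_right hxρ, ENNReal.ofReal_mul (by positivity),
      ENNReal.ofReal_pow (by positivity)]
  have key := hM.tendsto_lintegral_collar hφ hφ0
  have hfr : ∫⁻ x in frontier M, ENNReal.ofReal (φ x)
      ∂(Measure.euclideanHausdorffMeasure (n - 1)) = weightedPerimeter n a M := by
    refine setLIntegral_congr_fun isClosed_frontier.measurableSet fun x hx => heq x ?_
    rw [hopen.frontier_eq] at hx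
    exact hx.2
  rw [hfr] at key
  rw [minkowskiContent]
  refine Tendsto.liminf_eq (key.congr' ?_)
  filter_upwards [self_mem_nhdsWithin] with r (hr : 0 < r)
  have hTm : MeasurableSet (Metric.thickening r M \ M) :=
    Metric.isOpen_thickening.measurableSet.diff hopen.measurableSet
  rw [← measure_sdiff (Metric.self_subset_thickening hr M) hopen.measurableSet.nullMeasurableSet
    hfin, radialMeasure, withDensity_apply _ hTm]
  congr 1
  exact setLIntegral_congr_fun hTm fun x hx => heq x hx.2

theorem weightedPerimeter_ball [NeZero n] (a : ℝ → ℝ) {R : ℝ} (hR : 0 < R) :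
    weightedPerimeter n a (Metric.ball 0 R) =
      (n : ℝ≥0∞) * unitBallVolume n * ENNReal.ofReal (Real.exp (a R)) := by
  have hS : Measure.euclideanHausdorffMeasure (n - 1)
      (Metric.sphere (0 : EuclideanSpace ℝ (Fin n)) 1) = (n : ℝ≥0∞) * unitBallVolume n := by
    have h := toSphere_apply_eq_euclideanHausdorffMeasure (n := n) Set.univ
    rw [Measure.toSphere_apply_univ, finrank_euclideanSpace_fin, Set.image_univ,
      Subtype.range_coe] at h
    exact h.symm
  have hSR : Measure.euclideanHausdorffMeasure (n - 1)
      (Metric.sphere (0 : EuclideanSpace ℝ (Fin n)) R) =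
      ENNReal.ofReal R ^ (n - 1) * ((n : ℝ≥0∞) * unitBallVolume n) := by
    have h := Measure.euclideanHausdorffMeasure_smul₀ (n - 1) hR.ne'
      (Metric.sphere (0 : EuclideanSpace ℝ (Fin n)) 1)
    rw [smul_sphere' hR.ne', smul_zero, mul_one, Real.norm_of_nonneg hR.le, hS] at h
    rw [h, ENNReal.smul_def, smul_eq_mul, ENNReal.coe_pow, ENNReal.ofReal,
      ← Real.toNNReal_eq_nnnorm_of_nonneg hR.le]
  rw [weightedPerimeter, frontier_ball _ hR.ne']
  have hcongr : ∀ x ∈ Metric.sphere (0 : EuclideanSpace ℝ (Fin n)) R, radialDensity n a x =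
      ENNReal.ofReal R⁻¹ ^ (n - 1) * ENNReal.ofReal (Real.exp (a R)) := by
    intro x hx
    rw [mem_sphere_zero_iff_norm] at hx
    rw [radialDensity_eq, hx]
  rw [setLIntegral_congr_fun Metric.isClosed_sphere.measurableSet hcongr, setLIntegral_const, hSR]
  have hinv : ENNReal.ofReal R⁻¹ ^ (n - 1) * ENNReal.ofReal R ^ (n - 1) = 1 := by
    rw [← mul_pow, ← ENNReal.ofReal_mul (by positivity), inv_mul_cancel₀ hR.ne',
      ENNReal.ofReal_one, one_pow]
  calc _ = (ENNReal.ofReal R⁻¹ ^ (n - 1) * ENNReal.ofReal R ^ (n - 1)) *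
        ((n : ℝ≥0∞) * unitBallVolume n * ENNReal.ofReal (Real.exp (a R))) := by ring
    _ = _ := by rw [hinv, one_mul]

/-- On every ray the first and the last exit points from `Ω` lie on the frontier. -/
theorem exists_mem_frontier_ray {Ω : Set (EuclideanSpace ℝ (Fin n))} (hΩ : IsOpen Ω)
    (hb : Bornology.IsBounded Ω) (h0 : (0 : EuclideanSpace ℝ (Fin n)) ∈ Ω)
    (θ : Metric.sphere (0 : EuclideanSpace ℝ (Fin n)) 1) :
    (∃ t : ℝ, 0 < t ∧ t • (θ : EuclideanSpace ℝ (Fin n)) ∈ frontier Ω ∧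
      ∀ r, 0 < r → r < t → r • (θ : EuclideanSpace ℝ (Fin n)) ∈ Ω) ∧
    (∃ v : ℝ, 0 < v ∧ v • (θ : EuclideanSpace ℝ (Fin n)) ∈ frontier Ω ∧
      ∀ r, 0 < r → r • (θ : EuclideanSpace ℝ (Fin n)) ∈ Ω → r ≤ v) := by
  have hcont : Continuous fun r : ℝ => r • (θ : EuclideanSpace ℝ (Fin n)) := by fun_prop
  obtain ⟨L, hL, hΩL⟩ := hb.subset_ball_lt 0 0
  set T : Set ℝ := (fun r : ℝ => r • (θ : EuclideanSpace ℝ (Fin n))) ⁻¹' Ω with hT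
  have hTo : IsOpen T := hΩ.preimage hcont
  have hT0 : (0 : ℝ) ∈ T := by simpa [hT] using h0
  have hTL : ∀ r ∈ T, r ≤ L := by
    intro r hr
    rcases le_total r 0 with h | h
    · exact h.trans hL.le
    · have := hΩL hr
      rw [mem_ball_zero_iff, norm_smul_sphere θ h] at this
      exact this.le
  have hfr : ∀ r, r ∈ closure T → r ∉ T → r • (θ : EuclideanSpace ℝ (Fin n)) ∈ frontier Ω := by
    intro r hr hrT
    rw [hΩ.frontier_eq]
    exact ⟨hcont.closure_preimage_subset _ hr, hrT⟩
  constructor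
  · set C : Set ℝ := Set.Ici 0 ∩ Tᶜ with hC
    have hCc : IsClosed C := isClosed_Ici.inter hTo.isClosed_compl
    have hCne : C.Nonempty := ⟨L + 1, by simp only [Set.mem_Ici]; linarith, fun h => by
      have := hTL _ h; linarith⟩
    have hCb : BddBelow C := ⟨0, fun r hr => hr.1⟩
    have hmem := hCc.csInf_mem hCne hCb
    have hpos : 0 < sInf C := by
      refine lt_of_le_of_ne hmem.1 fun h => hmem.2 ?_
      rw [← h]; exact hT0
    have hbelow : ∀ r, 0 < r → r < sInf C → r ∈ T := by
      intro r hr hrC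
      by_contra h
      exact absurd (csInf_le hCb ⟨hr.le, h⟩) (not_le.2 hrC)
    refine ⟨sInf C, hpos, hfr _ ?_ hmem.2, hbelow⟩
    refine closure_mono (s := Set.Ioo 0 (sInf C)) (fun r hr => hbelow r hr.1 hr.2) ?_
    rw [closure_Ioo hpos.ne]
    exact ⟨hpos.le, le_rfl⟩
  · have hbdd : BddAbove T := ⟨L, hTL⟩
    have hlub := isLUB_csSup ⟨0, hT0⟩ hbdd
    have hnot : sSup T ∉ T := by
      intro h
      obtain ⟨δ, hδ, hball⟩ := Metric.isOpen_iff.1 hTo _ h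
      have : sSup T + δ / 2 ∈ T := hball (by
        rw [Metric.mem_ball, Real.dist_eq, add_sub_cancel_left, abs_of_pos (half_pos hδ)]
        linarith)
      have := hlub.1 this
      linarith
    refine ⟨sSup T, lt_of_le_of_ne (hlub.1 hT0) fun h => hnot (h ▸ hT0),
      hfr _ (hlub.mem_closure ⟨0, hT0⟩) hnot, fun r _ hr => hlub.1 hr⟩

/-- Jensen's inequality for the ray masses `m θ`, whose mean is `A R`, written with the supporting
line at `A R` and transferred to the frontier by radial projection. -/
theorem le_weightedPerimeter [NeZero n] (ha : Continuous a) (hconv : ConvexOn ℝ (Set.Ici 0) a)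
    {Ω : Set (EuclideanSpace ℝ (Fin n))} (hΩ : IsOpen Ω) (hb : Bornology.IsBounded Ω)
    (h0 : (0 : EuclideanSpace ℝ (Fin n)) ∈ Ω) {R : ℝ} (hR : 0 < R)
    (hRΩ : radialMeasure n a (Metric.ball 0 R) = radialMeasure n a Ω) :
    (n : ℝ≥0∞) * unitBallVolume n * ENNReal.ofReal (Real.exp (a R)) ≤ weightedPerimeter n a Ω := by
  obtain ⟨c, hc⟩ := hconv.exists_exp_supporting_line ha hR
  set A : ℝ → ℝ := fun s => ∫ u in (0 : ℝ)..s, Real.exp (a u) with hA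
  set σ := (volume : Measure (EuclideanSpace ℝ (Fin n))).toSphere with hσ
  have hAnonneg : ∀ s, 0 ≤ s → 0 ≤ A s := by
    intro s hs
    have := (strictMono_integral_exp ha).monotone hs
    simpa using this
  obtain ⟨L, hL, hΩL⟩ := hb.subset_ball_lt 0 0
  have hσuniv : σ Set.univ = (n : ℝ≥0∞) * unitBallVolume n := by
    rw [hσ, Measure.toSphere_apply_univ, finrank_euclideanSpace_fin]; rfl
  have hmle : ∀ θ, rayMass a Ω θ ≤ ENNReal.ofReal (A L) := fun θ =>
    rayMass_le ha hL.le fun r hr h => by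
      have := hΩL h
      rw [mem_ball_zero_iff, norm_smul_sphere θ hr.le] at this
      exact this.le
  have hmtop : ∀ θ, rayMass a Ω θ ≠ ⊤ := fun θ =>
    ne_top_of_le_ne_top ENNReal.ofReal_ne_top (hmle θ)
  have hmm := measurable_rayMass ha hΩ.measurableSet
  set m : Metric.sphere (0 : EuclideanSpace ℝ (Fin n)) 1 → ℝ := fun θ => (rayMass a Ω θ).toReal
    with hm
  have hmint : Integrable m σ := by
    refine Integrable.of_bound (C := A L) hmm.ennreal_toReal.aestronglyMeasurable
      (Eventually.of_forall fun θ => ?_)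
    rw [Real.norm_of_nonneg ENNReal.toReal_nonneg]
    exact ENNReal.toReal_le_of_le_ofReal (hAnonneg L hL.le) (hmle θ)
  have hmI : ∫ θ, m θ ∂σ = σ.real Set.univ * A R := by
    rw [integral_toReal hmm.aemeasurable (Eventually.of_forall fun θ => (hmtop θ).lt_top),
      ← radialMeasure_apply ha hΩ.measurableSet, ← hRΩ, radialMeasure_ball ha hR.le,
      ← hσuniv, ENNReal.toReal_mul, ENNReal.toReal_ofReal (hAnonneg R hR.le)]
    rfl
  set q : Metric.sphere (0 : EuclideanSpace ℝ (Fin n)) 1 → ℝ :=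
    fun θ => Real.exp (a R) + c * (m θ - A R) with hq
  have hcint : Integrable (fun θ => c * (m θ - A R)) σ :=
    (hmint.sub (integrable_const _)).const_mul c
  have hqint : Integrable q σ := (integrable_const _).add hcint
  have hqI : ∫ θ, q θ ∂σ = σ.real Set.univ * Real.exp (a R) := by
    simp only [hq]
    rw [integral_add (integrable_const _) hcint,
      integral_const_mul, integral_sub hmint (integrable_const _), hmI]
    simp
  have hexit : ∀ θ : Metric.sphere (0 : EuclideanSpace ℝ (Fin n)) 1, ∃ r : ℝ, 0 < r ∧
      r • (θ : EuclideanSpace ℝ (Fin n)) ∈ frontier Ω ∧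
      max (q θ) 0 ≤ Real.exp (a ‖r • (θ : EuclideanSpace ℝ (Fin n))‖) := by
    intro θ
    obtain ⟨⟨t, ht, htf, htΩ⟩, ⟨v, hv, hvf, hvΩ⟩⟩ := exists_mem_frontier_ray hΩ hb h0 θ
    have htm : A t ≤ m θ :=
      (ENNReal.ofReal_le_iff_le_toReal (hmtop θ)).1 (le_rayMass ha ht.le htΩ)
    have hmv : m θ ≤ A v :=
      ENNReal.toReal_le_of_le_ofReal (hAnonneg v hv.le) (rayMass_le ha hv.le hvΩ)
    -- The line must not decrease in passing from `m θ` to `A` of the exit radius: `c ≥ 0` calls for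
    -- the last exit `v`, `c ≤ 0` for the first exit `t`.
    rcases le_total 0 c with h | h
    · refine ⟨v, hv, hvf, max_le ?_ (Real.exp_pos _).le⟩
      rw [norm_smul_sphere θ hv.le]
      refine le_trans ?_ (hc v hv.le)
      simp only [hq]
      gcongr
    · refine ⟨t, ht, htf, max_le ?_ (Real.exp_pos _).le⟩
      rw [norm_smul_sphere θ ht.le]
      refine le_trans ?_ (hc t ht.le)
      simp only [hq]
      have : c * (m θ - A R) ≤ c * (A t - A R) :=
        mul_le_mul_of_nonpos_left (by linarith) h
      linarith
  have hqm : Measurable fun θ => max (q θ) 0 := by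
    have := hmm.ennreal_toReal
    simp only [hq, hm]
    fun_prop
  have key := lintegral_toSphere_le_of_exists_mem (isClosed_frontier (s := Ω)).measurableSet
    (G := fun x => Real.exp (a ‖x‖)) (by fun_prop) (fun x => (Real.exp_pos _).le) hqm
    (fun θ => le_max_right _ _) hexit
  have hper : ∫⁻ x in frontier Ω, ENNReal.ofReal ‖x‖⁻¹ ^ (n - 1) *
      ENNReal.ofReal (Real.exp (a ‖x‖)) ∂(Measure.euclideanHausdorffMeasure (n - 1)) =
      weightedPerimeter n a Ω := by
    rw [weightedPerimeter]
    exact lintegral_congr fun x => (radialDensity_eq a x).symm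
  rw [hper] at key
  refine le_trans ?_ key
  -- The line may be negative at some `m θ`; its positive part is still below `exp a` at the exit
  -- point, and its integral is at least that of `q`.
  have hqpint : Integrable (fun θ => max (q θ) 0) σ := hqint.sup (integrable_const 0)
  rw [← ofReal_integral_eq_lintegral_ofReal hqpint (Eventually.of_forall fun θ => le_max_right _ _)]
  calc (n : ℝ≥0∞) * unitBallVolume n * ENNReal.ofReal (Real.exp (a R))
      = ENNReal.ofReal (∫ θ, q θ ∂σ) := by
        rw [hqI, ENNReal.ofReal_mul measureReal_nonneg, ofReal_measureReal, hσuniv]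
    _ ≤ _ := ENNReal.ofReal_le_ofReal
        (integral_mono hqint hqpint fun θ => le_max_left _ _)

end RadialMeasure

theorem mainTheorem10 (n : ℕ) (hn : 1 ≤ n) (a : ℝ → ℝ)
    (ha_cont : ContinuousOn a (Set.Ici 0)) (ha_conv : ConvexOn ℝ (Set.Ici 0) a)
    (Ω : Set (EuclideanSpace ℝ (Fin n))) (hΩ : IsSmoothSet Ω)
    (hΩ_zero : Ω ∈ 𝓝 (0 : EuclideanSpace ℝ (Fin n)))
    (hΩ_fin : radialMeasure n a Ω < ⊤) :
    (∃! R : ℝ, 0 < R ∧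
      radialMeasure n a (Metric.ball 0 R) = radialMeasure n a Ω) ∧
    ∀ R : ℝ, 0 < R → radialMeasure n a (Metric.ball 0 R) = radialMeasure n a Ω →
      minkowskiContent (radialMeasure n a) Ω = weightedPerimeter n a Ω ∧
      (n : ENNReal) * unitBallVolume n * ENNReal.ofReal (Real.exp (a R))
        ≤ weightedPerimeter n a Ω ∧
      minkowskiContent (radialMeasure n a) (Metric.ball 0 R)
        = (n : ENNReal) * unitBallVolume n * ENNReal.ofReal (Real.exp (a R)) ∧
      weightedPerimeter n a (Metric.ball 0 R)
        = (n : ENNReal) * unitBallVolume n * ENNReal.ofReal (Real.exp (a R)) := by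
  have : NeZero n := ⟨by omega⟩
  -- The even extension is continuous on all of `ℝ` and agrees with `a` on `[0, ∞)`, which is all
  -- that density, convexity and statement involve.
  set b : ℝ → ℝ := fun s => a |s| with hb
  have hbc : Continuous b := ha_cont.comp_continuous continuous_abs fun s => abs_nonneg s
  have hab : Set.EqOn a b (Set.Ici 0) := fun s hs => by rw [hb]; simp only [abs_of_nonneg hs.out]
  have hbconv : ConvexOn ℝ (Set.Ici 0) b := ha_conv.congr hab
  have hdens : radialDensity n a = radialDensity n b := by
    ext x
    rw [radialDensity, radialDensity, hab (norm_nonneg x)]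
  have hmeas : radialMeasure n a = radialMeasure n b := by rw [radialMeasure, hdens, radialMeasure]
  have hper : ∀ M, weightedPerimeter n a M = weightedPerimeter n b M := fun M => by
    rw [weightedPerimeter, hdens, weightedPerimeter]
  rw [hmeas] at hΩ_fin ⊢
  refine ⟨existsUnique_radialMeasure_ball_eq hbc hΩ.1 hΩ_zero, fun R hR hRΩ => ?_⟩
  rw [hper, hper, hab hR.le]
  refine ⟨hΩ.minkowskiContent_eq_weightedPerimeter hbc hΩ_zero hΩ_fin.ne,
    le_weightedPerimeter hbc hbconv hΩ.2.1 hΩ.1 (mem_of_mem_nhds hΩ_zero) hR hRΩ, ?_,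
    weightedPerimeter_ball b hR⟩
  rw [(isSmoothSet_ball hR).minkowskiContent_eq_weightedPerimeter hbc (Metric.ball_mem_nhds 0 hR)
    (by rw [hRΩ]; exact hΩ_fin.ne), weightedPerimeter_ball b hR]
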